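/- Let $M$ be a (finite-dimensional) real-analytic manifold, $\pi:E\to M$ a real-analytic vector bundle of finite rank, and $\nabla$ a real-analytic connection on $E$, with curvature tensor $R(X,Y)\xi=\nabla_X\nabla_Y\xi-\nabla_Y\nabla_X\xi-\nabla_{[X,Y]}\xi$. Fix any smooth connection $D$ on $TM$, and let $\nabla^kR$ denote the $k$-th covariant derivative of $R$, formed with $\nabla$ on $E$ and $D$ on $TM$: $\nabla^0R=R$ and, for vector fields $X_1,\dots,X_{k+3}$ and a section $\xi$ of $E$, $$(\nabla^{k+1}R)(X_1,\dots,X_{k+3})\xi=\nabla_{X_1}\big((\nabla^kR)(X_2,\dots,X_{k+3})\xi\big)-\sum_{i=2}^{k+3}(\nabla^kR)(X_2,\dots,D_{X_1}X_i,\dots,X_{k+3})\xi-(\nabla^kR)(X_2,\dots,X_{k+3})\nabla_{X_1}\xi .$$ Let $x\in M$ and $e\in E_x=\pi^{-1}(x)$, and assume that $$(\nabla^kR)(v_1,v_2,\dots,v_{k+2})\,e=0$$ for all $k\ge 0$ and all $v_1,\dots,v_{k+2}\in T_xM$. Then there exists a smooth section $s$ of $E$, defined in an open neighborhood of $x$ in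 $M$, that is parallel ($\nabla s=0$) and satisfies $s(x)=e$. If moreover $M$ is (connected and) simply connected, then there exists a global smooth parallel section $s:M\to E$ with $s(x)=e$. -/

import Mathlib

open Bundle Set
open scoped Manifold ContDiff Topology

noncomputable section

namespace CovariantDerivative

variable {B : Type*} [NormedAddCommGroup B] [NormedSpace ℝ B]
  {H : Type*} [TopologicalSpace H] {I : ModelWithCorners ℝ B H}
  {M : Type*} [TopologicalSpace M] [ChartedSpace H M] [IsManifold I 1 M]
  {F : Type*} [NormedAddCommGroup F] [NormedSpace ℝ F]
  {V : M → Type*} [TopologicalSpace (TotalSpace F V)]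
  [∀ x, AddCommGroup (V x)] [∀ x, Module ℝ (V x)]
  [∀ x, TopologicalSpace (V x)]
  [∀ x, IsTopologicalAddGroup (V x)] [∀ x, ContinuousSMul ℝ (V x)]
  [FiberBundle F V]

/-- The connection `∇` is of class `C^n`: for every open set `U`, the connection induced on the
restriction of the bundle to `U` sends sections of class `C^(n+1)` on `U` to sections of class `C^n`
of `Hom(TM, V)` on `U`. Equivalently, the connection coefficients in local frames are `C^n`.
For `n = ω` this says that the connection is real-analytic, for `n = ∞` that it is smooth.
(The condition is imposed on all open sets, as global analytic sections are scarce.) -/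
def IsOfClass [VectorBundle ℝ F V]
    (nabla : CovariantDerivative I F V) (n : ℕ∞ω) : Prop :=
  ∀ U : Set M, IsOpen U → ContMDiffCovariantDerivativeOn F n nabla.toFun U

/-- The derivative `∇_X σ` of the section `σ` along the vector field `X`. -/
def along (nabla : CovariantDerivative I F V) (X : Π x : M, TangentSpace I x)
    (σ : Π x : M, V x) : Π x : M, V x :=
  fun x ↦ nabla σ x (X x)

/-- The section `σ` is parallel on `U`: `∇_v σ = 0` for all `y ∈ U` and all `v ∈ T_y M`.
(Used for open sets `U` and for `σ` smooth on `U` only.) -/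
def IsParallelOn (nabla : CovariantDerivative I F V) (σ : Π x : M, V x) (U : Set M) : Prop :=
  ∀ y ∈ U, ∀ v : TangentSpace I y, nabla σ y v = 0

/-- The curvature `R(X, Y)σ = ∇_X ∇_Y σ - ∇_Y ∇_X σ - ∇_{[X, Y]} σ` applied to fields. -/
def curvatureOp (nabla : CovariantDerivative I F V) (X Y : Π x : M, TangentSpace I x)
    (σ : Π x : M, V x) : Π x : M, V x :=
  nabla.along X (nabla.along Y σ) - nabla.along Y (nabla.along X σ)
    - nabla.along (VectorField.mlieBracket I X Y) σ

/-- The covariant derivative of an `End V`-valued covariant `n`-tensor field `τ`, everything being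
applied to fields; it is formed with the connection `∇` on `V` and a connection `D` on `TM`:
`(∇τ)(X₀, X₁, …, Xₙ)σ
  = ∇_{X₀}(τ(X₁, …, Xₙ)σ) - ∑ᵢ τ(X₁, …, D_{X₀} Xᵢ, …, Xₙ)σ - τ(X₁, …, Xₙ)(∇_{X₀} σ)`. -/
def tensorDeriv (nabla : CovariantDerivative I F V)
    (D : CovariantDerivative I B (TangentSpace I : M → Type _)) {n : ℕ}
    (τ : (Fin n → Π x : M, TangentSpace I x) → (Π x : M, V x) → Π x : M, V x)
    (X : Fin (n + 1) → Π x : M, TangentSpace I x) (σ : Π x : M, V x) : Π x : M, V x :=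
  nabla.along (X 0) (τ (Fin.tail X) σ)
    - ∑ i : Fin n, τ (Function.update (Fin.tail X) i (D.along (X 0) (Fin.tail X i))) σ
    - τ (Fin.tail X) (nabla.along (X 0) σ)

/-- The iterated covariant derivative `(∇^k R)(X₁, …, X_{k+2})σ` of the curvature, applied to
fields; the `k` directions of differentiation come first, that of the outermost derivative in front. -/
def iteratedCurvatureOp (nabla : CovariantDerivative I F V)
    (D : CovariantDerivative I B (TangentSpace I : M → Type _)) : (k : ℕ) →
    (Fin (k + 2) → Π x : M, TangentSpace I x) → (Π x : M, V x) → Π x : M, V x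
  | 0 => fun X σ ↦ nabla.curvatureOp (X 0) (X 1) σ
  | k + 1 => nabla.tensorDeriv D (nabla.iteratedCurvatureOp D k)

/-- The tensor `(∇^k R)(v₁, …, v_{k+2})e` at the point `x`, for `vᵢ ∈ T_x M` and `e` in the fibre
over `x`. As `∇^k R` is a tensor, it may be computed with any extensions of the `vᵢ` and of `e` to
fields that are smooth near `x`; those that are constant in the local trivializations at `x`
are taken here. -/
def iteratedCurvature [VectorBundle ℝ F V] (nabla : CovariantDerivative I F V)
    (D : CovariantDerivative I B (TangentSpace I : M → Type _)) (k : ℕ) (x : M)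
    (v : Fin (k + 2) → TangentSpace I x) (e : V x) : V x :=
  nabla.iteratedCurvatureOp D k (fun i ↦ FiberBundle.extend B (v i)) (FiberBundle.extend F e) x

end CovariantDerivative

end

/-! In a chart and a trivialization, `∇` is `d + A` with `A` analytic, and a parallel section is a
solution of `ds = -As`. Solving this equation only along the rays from the centre always works.
Written as a Volterra integral equation on `[0, 1]`, it is solved by inverting an operator that
depends analytically on the ray, so the radial solution `s` is analytic
(`exists_radial_of_hasFPowerSeriesOnBall`).

The hypothesis on `∇^k R` makes `s` parallel in all directions (`parallel_of_radial`). Along a ray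
with direction `h`, the derivative of `(∇^k R)(X)s` is `(∇^{k+1} R)(h, X)s` plus terms built from
`∇^k R` applied to `s`. All these vanish at the centre, so `R s` vanishes there to infinite order
along the ray (`isBigO_iterCurv_ray`). Being analytic in the parameter, it vanishes on the whole
ray. The auxiliary connection on `TM` enters only through this flatness at the centre, so it need
only be smooth. With `R(h, ·)s = 0`, the form `ψ = ∇s` satisfies a homogeneous linear equation along
rays and is zero.

`coord_iteratedCurvatureOp` translates the invariant tensors `∇^k R` into coordinates and so gives
the local statement.

For the global statement, each point `p` has a neighbourhood `N` over which every germ of a parallel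
section at a point of `N` extends, uniquely (`exists_nhds_parallel`). Such a germ is itself
annihilated by all `∇^k R`, and the radius of existence is uniform near `p`. Hence the vectors with
a local parallel extension form a local system, its étalé space covers `M`, and over a simply
connected base the identity lifts (`exists_section_of_simplyConnected`). -/

/-! ### Connection forms on a normed space

A connection form is a function `A : B → B →L[ℝ] G`, where `G` acts on `F` through
`m : G →L[ℝ] F →L[ℝ] F`, and `ad` is a bilinear bracket on `G` which `m` turns into commutators. -/

namespace ConnectionForm

variable {B F G : Type*} [NormedAddCommGroup B] [NormedSpace ℝ B]
  [NormedAddCommGroup F] [NormedSpace ℝ F] [NormedAddCommGroup G] [NormedSpace ℝ G]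

/-- The curvature `dA + A ∧ A` of the connection `d + A`. -/
noncomputable def curv (ad : G →L[ℝ] G →L[ℝ] G) (A : B → B →L[ℝ] G) (z : B) :
    B →L[ℝ] B →L[ℝ] G :=
  fderiv ℝ A z - (fderiv ℝ A z).flip + (ad.flip.comp (A z)).flip.comp (A z)

lemma curv_apply (ad : G →L[ℝ] G →L[ℝ] G) (A : B → B →L[ℝ] G) (z v w : B) :
    curv ad A z v w = fderiv ℝ A z v w - fderiv ℝ A z w v + ad (A z v) (A z w) := by
  simp [curv]

set_option synthInstance.maxHeartbeats 200000 in
lemma contDiff_flip {m : ℕ∞ω} : ContDiff ℝ m (fun L : B →L[ℝ] F →L[ℝ] G ↦ L.flip) :=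
  (IsBoundedLinearMap.mk (𝕜 := ℝ) (f := fun L : B →L[ℝ] F →L[ℝ] G ↦ L.flip)
    ⟨fun _ _ ↦ rfl, fun _ _ ↦ rfl⟩ ⟨1, one_pos, fun L ↦ by simp⟩).contDiff

set_option synthInstance.maxHeartbeats 200000 in
lemma contDiffOn_curv {ad : G →L[ℝ] G →L[ℝ] G} {A : B → B →L[ℝ] G} {U : Set B} (hU : IsOpen U)
    {m n : ℕ∞ω} (hmn : m + 1 ≤ n) (hA : ContDiffOn ℝ n A U) : ContDiffOn ℝ m (curv ad A) U := by
  have h1 : ContDiffOn ℝ m (fderiv ℝ A) U := hA.fderiv_of_isOpen hU hmn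
  have h0 : ContDiffOn ℝ m A U := hA.of_le (le_trans le_self_add hmn)
  have h2 : ContDiffOn ℝ m (fun z ↦ (fderiv ℝ A z).flip) U :=
    contDiff_flip.comp_contDiffOn h1
  have h3 : ContDiffOn ℝ m (fun z ↦ (ad.flip.comp (A z)).flip) U :=
    contDiff_flip.comp_contDiffOn (contDiffOn_const.clm_comp h0)
  exact (h1.sub h2).add (h3.clm_comp h0)

/-- The covariant derivative of an endomorphism-valued tensor field, with respect to the
connection `d + A` on `F` and the connection `d + Γ` on `B`. -/
noncomputable def tensorCov (ad : G →L[ℝ] G →L[ℝ] G) (A : B → B →L[ℝ] G)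
    (Γ : B → B →L[ℝ] B →L[ℝ] B) {n : ℕ}
    (T : B → ContinuousMultilinearMap ℝ (fun _ : Fin n ↦ B) G) (z : B) :
    ContinuousMultilinearMap ℝ (fun _ : Fin (n + 1) ↦ B) G :=
  (continuousMultilinearCurryLeftEquiv ℝ (fun _ : Fin (n + 1) ↦ B) G).symm
    (fderiv ℝ T z
      + ((ContinuousLinearMap.compContinuousMultilinearMapL ℝ (fun _ : Fin n ↦ B)
          G G).flip (T z)).comp (ad.comp (A z))
      - ∑ i : Fin n, (((ContinuousMultilinearMap.compContinuousLinearMapContinuousMultilinear ℝ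
          (fun _ : Fin n ↦ B) (fun _ : Fin n ↦ B) G).toContinuousLinearMap
            (fun _ ↦ ContinuousLinearMap.id ℝ B) i).flip (T z)).comp (Γ z))

lemma tensorCov_apply (ad : G →L[ℝ] G →L[ℝ] G) (A : B → B →L[ℝ] G)
    (Γ : B → B →L[ℝ] B →L[ℝ] B) {n : ℕ}
    (T : B → ContinuousMultilinearMap ℝ (fun _ : Fin n ↦ B) G) (z : B)
    (v : Fin (n + 1) → B) :
    tensorCov ad A Γ T z v = fderiv ℝ T z (v 0) (Fin.tail v) + ad (A z (v 0)) (T z (Fin.tail v))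
      - ∑ i : Fin n, T z (Function.update (Fin.tail v) i (Γ z (v 0) (Fin.tail v i))) := by
  simp only [tensorCov, continuousMultilinearCurryLeftEquiv_symm_apply,
    sub_apply, add_apply, sum_apply]
  congr 1
  refine Finset.sum_congr rfl fun i _ ↦ ?_
  simp only [ContinuousLinearMap.comp_apply, ContinuousLinearMap.flip_apply,
    ContinuousMultilinearMap.toContinuousLinearMap_apply,
    ContinuousMultilinearMap.compContinuousLinearMapContinuousMultilinear_apply_apply]
  rw [ContinuousMultilinearMap.compContinuousLinearMap_apply]
  congr 1
  ext j
  rcases eq_or_ne j i with rfl | h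
  · simp
  · simp [h]

set_option synthInstance.maxHeartbeats 200000 in
lemma contDiffOn_tensorCov {ad : G →L[ℝ] G →L[ℝ] G} {A : B → B →L[ℝ] G}
    {Γ : B → B →L[ℝ] B →L[ℝ] B} {n : ℕ}
    {T : B → ContinuousMultilinearMap ℝ (fun _ : Fin n ↦ B) G} {U : Set B}
    (hU : IsOpen U) (hA : ContDiffOn ℝ ∞ A U) (hΓ : ContDiffOn ℝ ∞ Γ U)
    (hT : ContDiffOn ℝ ∞ T U) : ContDiffOn ℝ ∞ (tensorCov ad A Γ T) U := by
  refine (LinearIsometryEquiv.contDiff _).comp_contDiffOn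
    (((hT.fderiv_of_isOpen hU (by simp)).add ?_).sub (ContDiffOn.sum fun i _ ↦ ?_))
  · exact ((ContinuousLinearMap.contDiff _).comp_contDiffOn hT).clm_comp
      (contDiffOn_const.clm_comp hA)
  · exact ((ContinuousLinearMap.contDiff _).comp_contDiffOn hT).clm_comp hΓ

/-- The iterated covariant derivatives of the curvature of `d + A`. -/
noncomputable def iterCurv (ad : G →L[ℝ] G →L[ℝ] G) (A : B → B →L[ℝ] G)
    (Γ : B → B →L[ℝ] B →L[ℝ] B) :
    (k : ℕ) → B → ContinuousMultilinearMap ℝ (fun _ : Fin (k + 2) ↦ B) G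
  | 0 => fun z ↦ ((continuousMultilinearCurryLeftEquiv ℝ (fun _ : Fin 2 ↦ B) G).symm
      (((continuousMultilinearCurryFin1 ℝ B G).symm :
        (B →L[ℝ] G) →L[ℝ] _).comp (curv ad A z)))
  | k + 1 => tensorCov ad A Γ (iterCurv ad A Γ k)

lemma iterCurv_zero_apply (ad : G →L[ℝ] G →L[ℝ] G) (A : B → B →L[ℝ] G)
    (Γ : B → B →L[ℝ] B →L[ℝ] B) (z : B)
    (v : Fin 2 → B) : iterCurv ad A Γ 0 z v = curv ad A z (v 0) (v 1) := rfl

lemma iterCurv_succ (ad : G →L[ℝ] G →L[ℝ] G) (A : B → B →L[ℝ] G)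
    (Γ : B → B →L[ℝ] B →L[ℝ] B) (k : ℕ) :
    iterCurv ad A Γ (k + 1) = tensorCov ad A Γ (iterCurv ad A Γ k) := rfl

set_option synthInstance.maxHeartbeats 200000 in
lemma contDiffOn_iterCurv {ad : G →L[ℝ] G →L[ℝ] G} {A : B → B →L[ℝ] G}
    {Γ : B → B →L[ℝ] B →L[ℝ] B} {U : Set B}
    (hU : IsOpen U) (hA : ContDiffOn ℝ ∞ A U) (hΓ : ContDiffOn ℝ ∞ Γ U) (k : ℕ) :
    ContDiffOn ℝ ∞ (iterCurv ad A Γ k) U := by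
  induction k with
  | zero =>
    exact (LinearIsometryEquiv.contDiff _).comp_contDiffOn
      (contDiffOn_const.clm_comp (contDiffOn_curv hU (by simp) hA))
  | succ k ih => exact contDiffOn_tensorCov hU hA hΓ ih

/-- Differentiating a tensor field applied to vector fields, in terms of the covariant
derivative. -/
lemma fderiv_tensor_apply (ad : G →L[ℝ] G →L[ℝ] G) (A : B → B →L[ℝ] G)
    (Γ : B → B →L[ℝ] B →L[ℝ] B) {n : ℕ}
    {T : B → ContinuousMultilinearMap ℝ (fun _ : Fin n ↦ B) G} {z : B}
    (hT : DifferentiableAt ℝ T z) {X : Fin n → B → B} (hX : ∀ i, DifferentiableAt ℝ (X i) z)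
    (v : B) :
    fderiv ℝ (fun y ↦ T y (X · y)) z v + ad (A z v) (T z (X · z)) =
      tensorCov ad A Γ T z (Fin.cons v (X · z)) + ∑ i, T z (Function.update (X · z) i
        (fderiv ℝ (X i) z v + Γ z v (X i z))) := by
  rw [(hT.hasFDerivAt.continuousMultilinearMap_apply fun i ↦ (hX i).hasFDerivAt).fderiv]
  simp only [tensorCov_apply, Fin.cons_zero, Fin.tail_cons, add_apply,
    sum_apply, ContinuousMultilinearMap.map_update_add,
    Finset.sum_add_distrib, ContinuousLinearMap.comp_apply]
  simp only [ContinuousMultilinearMap.apply_apply,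
    ContinuousMultilinearMap.toContinuousLinearMap_apply]
  abel

/-- A solution of `Ds + As = 0` is annihilated by all covariant derivatives of the curvature. -/
theorem iterCurv_parallel_eq_zero {ad : G →L[ℝ] G →L[ℝ] G} {m : G →L[ℝ] F →L[ℝ] F}
    (hm : ∀ a b f, m (ad a b) f = m a (m b f) - m b (m a f))
    {A : B → B →L[ℝ] G} {Γ : B → B →L[ℝ] B →L[ℝ] B}
    {U : Set B} (hU : IsOpen U) (hA : ContDiffOn ℝ ∞ A U) (hΓ : ContDiffOn ℝ ∞ Γ U) {s : B → F}
    (hs : ∀ z ∈ U, HasFDerivAt s (-(m.flip (s z)).comp (A z)) z) (k : ℕ) :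
    ∀ z ∈ U, ∀ v : Fin (k + 2) → B, m (iterCurv ad A Γ k z v) (s z) = 0 := by
  induction k with
  | zero =>
    intro z hz v
    have hA' : HasFDerivAt A (fderiv ℝ A z) z :=
      ((hA.contDiffAt (hU.mem_nhds hz)).differentiableAt (by simp)).hasFDerivAt
    -- This differentiates `ds = -As`. Symmetry of the second derivative of `s` then says exactly
    -- that the curvature kills `s`.
    have h2 := ((m.flip.hasFDerivAt.comp z (hs z hz)).clm_comp hA').neg
    have := second_derivative_symmetric_of_eventually
      (Filter.eventually_of_mem (hU.mem_nhds hz) fun y hy ↦ hs y hy) h2 (v 0) (v 1)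
    simp at this
    rw [iterCurv_zero_apply, curv_apply]
    simp only [map_add, map_sub, add_apply, sub_apply, hm]
    linear_combination (norm := module) (-1 : ℝ) • this
  | succ k ih =>
    intro z hz v
    have hT : DifferentiableAt ℝ (iterCurv ad A Γ k) z :=
      ((contDiffOn_iterCurv hU hA hΓ k).contDiffAt (hU.mem_nhds hz)).differentiableAt (by simp)
    -- Differentiate the identity of order `k`, with constant vectors as arguments. The terms of the
    -- covariant derivative containing `Γ`, and the one where `A` acts after the tensor, vanish by
    -- induction.
    have h1 : HasFDerivAt (fun y ↦ m (iterCurv ad A Γ k y (Fin.tail v)) (s y))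
        (0 : B →L[ℝ] F) z := by
      refine (hasFDerivAt_const (0 : F) z).congr_of_eventuallyEq ?_
      filter_upwards [hU.mem_nhds hz] with y hy using ih y hy _
    have h2 := (m.hasFDerivAt.comp z
      (hT.hasFDerivAt.continuousMultilinear_apply_const (Fin.tail v))).clm_apply (hs z hz)
    have := congrArg (fun L ↦ L (v 0)) (h2.unique h1)
    simp at this
    simp only [iterCurv_succ, tensorCov_apply]
    simp [ih z hz, hm]
    linear_combination (norm := module) this

end ConnectionForm

/-! ### Linear differential equations along rays -/

section Ray

variable {F : Type*} [NormedAddCommGroup F] [NormedSpace ℝ F]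

/-- A solution of a homogeneous linear differential equation on `[0, 1]` vanishing at `0`
vanishes at `1`. -/
lemma eq_zero_of_hasDerivAt_linear {c : ℝ → F →L[ℝ] F} (hc : ContinuousOn c (Icc 0 1))
    {g : ℝ → F} (hg : ∀ t ∈ Icc (0 : ℝ) 1, HasDerivAt g (c t (g t)) t) (h0 : g 0 = 0) :
    g 1 = 0 := by
  obtain ⟨K, hK⟩ := isCompact_Icc.exists_bound_of_continuousOn hc
  refine eq_zero_of_abs_deriv_le_mul_abs_self_of_eq_zero_right (K := K) (a := 0) (b := 1)
    (fun t ht ↦ (hg t ht).continuousAt.continuousWithinAt)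
    (fun t ht ↦ (hg t (Ico_subset_Icc_self ht)).hasDerivWithinAt) h0 (fun t ht ↦ ?_) 1 (by simp)
  exact (c t).le_of_opNorm_le (hK t (Ico_subset_Icc_self ht)) _

-- Mean value inequality on the interval of radius `|t|`. It raises the order of vanishing by one in
-- `isBigO_iterCurv_ray`.
open Asymptotics in
lemma isBigO_pow_succ_of_deriv {g g' : ℝ → F} {n : ℕ}
    (hg : ∀ᶠ t in 𝓝 (0 : ℝ), HasDerivAt g (g' t) t) (h0 : g 0 = 0)
    (h : g' =O[𝓝 0] fun t : ℝ ↦ t ^ n) : g =O[𝓝 0] fun t : ℝ ↦ t ^ (n + 1) := by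
  obtain ⟨C, hC⟩ := h.bound
  obtain ⟨ε, hε, hb⟩ := Metric.eventually_nhds_iff_ball.1 (hg.and hC)
  refine IsBigO.of_bound C ?_
  filter_upwards [Metric.ball_mem_nhds 0 hε] with t ht
  have hsub : ∀ y ∈ Metric.closedBall (0 : ℝ) |t|, y ∈ Metric.ball (0 : ℝ) ε := fun y hy ↦ by
    simp only [Metric.mem_ball, dist_zero_right, Real.norm_eq_abs, Metric.mem_closedBall] at *
    exact hy.trans_lt ht
  have := (convex_closedBall (0 : ℝ) |t|).norm_image_sub_le_of_norm_hasDerivWithin_le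
    (f := g) (f' := g') (C := C * |t| ^ n) (x := 0) (y := t)
    (fun y hy ↦ (hb y (hsub y hy)).1.hasDerivWithinAt) (fun y hy ↦ ?_) (by simp) (by simp)
  · rw [h0, sub_zero, sub_zero] at this
    refine this.trans (le_of_eq ?_)
    rw [norm_pow, Real.norm_eq_abs]
    ring
  · have h1 := (hb y (hsub y hy)).2
    have h2 : 0 ≤ C ∨ ‖y ^ n‖ ≤ 0 := by
      by_contra! hcon
      have := norm_nonneg (g' y)
      nlinarith [hcon.1, hcon.2]
    have h3 : |y| ≤ |t| := by simpa using hy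
    have h4 : ‖y ^ n‖ ≤ |t| ^ n := by
      rw [norm_pow, Real.norm_eq_abs]; gcongr
    -- The constant of an `IsBigO` bound carries no sign; a negative one forces `|t| ^ n = 0`.
    rcases le_or_gt 0 C with hC0 | hC0
    · exact h1.trans (by gcongr)
    · have h5 := (hb t ht).2
      have h6 : |t| ^ n ≤ 0 := by
        by_contra! h7
        have := norm_nonneg (g' t)
        rw [norm_pow, Real.norm_eq_abs] at h5
        nlinarith
      have h7 : ‖y ^ n‖ = 0 := le_antisymm (h4.trans h6) (norm_nonneg _)
      have h8 : |t| ^ n = 0 := le_antisymm h6 (by positivity)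
      rw [h8]; rw [h7] at h1; simpa using h1

/-- Otherwise `f = t ^ n • g` near `0` with `g 0 ≠ 0`, and the bound of order `n + 1` forces `g t →
0`. -/
lemma eventually_eq_zero_of_isBigO_pow {f : ℝ → F} (hf : AnalyticAt ℝ f 0)
    (h : ∀ n : ℕ, f =O[𝓝 0] fun t : ℝ ↦ t ^ n) : ∀ᶠ t in 𝓝 (0 : ℝ), f t = 0 := by
  by_contra hcon
  obtain ⟨n, g, hg, hg0, hfg⟩ := hf.exists_eventuallyEq_pow_smul_nonzero_iff.2 hcon
  have h1 : (fun t : ℝ ↦ ‖g t‖) ≤ᶠ[𝓝[≠] 0] fun t ↦ (h (n + 1)).bound.choose * ‖t‖ := by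
    filter_upwards [nhdsWithin_le_nhds hfg, nhdsWithin_le_nhds (h (n + 1)).bound.choose_spec,
      self_mem_nhdsWithin] with t ht1 ht2 ht3
    have ht3 : t ≠ 0 := ht3
    rw [ht1, sub_zero, norm_smul, pow_succ, norm_mul] at ht2
    have : 0 < ‖t ^ n‖ := norm_pos_iff.2 (pow_ne_zero n ht3)
    refine le_of_mul_le_mul_left (ht2.trans (le_of_eq ?_)) this
    ring
  have h2 : Filter.Tendsto (fun t : ℝ ↦ ‖g t‖) (𝓝[≠] 0) (𝓝 ‖g 0‖) :=
    (hg.continuousAt.norm.tendsto).mono_left nhdsWithin_le_nhds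
  have h3 : Filter.Tendsto (fun t : ℝ ↦ (h (n + 1)).bound.choose * ‖t‖) (𝓝[≠] 0) (𝓝 0) := by
    refine Filter.Tendsto.mono_left ?_ nhdsWithin_le_nhds
    have : Continuous fun t : ℝ ↦ (h (n + 1)).bound.choose * ‖t‖ := by fun_prop
    simpa using this.tendsto 0
  exact hg0 (norm_le_zero_iff.1 (le_of_tendsto_of_tendsto h2 h3 h1))

end Ray

/-! ### From radially parallel to parallel sections -/

namespace ConnectionForm

variable {B F G : Type*} [NormedAddCommGroup B] [NormedSpace ℝ B]
  [NormedAddCommGroup F] [NormedSpace ℝ F] [NormedAddCommGroup G] [NormedSpace ℝ G]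

lemma hasDerivAt_add_smul (q h : B) (t : ℝ) : HasDerivAt (fun t : ℝ ↦ q + t • h) h t := by
  simpa using ((hasDerivAt_id t).smul_const h).const_add q

/-- A parallel section on a star-convex set vanishing at the centre vanishes. -/
theorem eq_zero_of_parallel {m : G →L[ℝ] F →L[ℝ] F} {A : B → B →L[ℝ] G} {Ω : Set B} {q : B}
    (hΩ : StarConvex ℝ q Ω) (hA : ContinuousOn A Ω) {s : B → F}
    (hs : ∀ z ∈ Ω, HasFDerivAt s (-(m.flip (s z)).comp (A z)) z) (h0 : s q = 0) :
    ∀ z ∈ Ω, s z = 0 := by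
  intro z hz
  have hmem : ∀ t ∈ Icc (0 : ℝ) 1, q + t • (z - q) ∈ Ω := fun t ht ↦
    hΩ.add_smul_sub_mem hz ht.1 ht.2
  have hcont : ContinuousOn (fun t : ℝ ↦ A (q + t • (z - q))) (Icc 0 1) :=
    hA.comp (by fun_prop) hmem
  have := eq_zero_of_hasDerivAt_linear (g := fun t ↦ s (q + t • (z - q)))
    (c := fun t ↦ -m (A (q + t • (z - q)) (z - q)))
    (m.continuous.comp_continuousOn (hcont.clm_apply continuousOn_const)).neg
    (fun t ht ↦ by
      simpa only [neg_apply, ContinuousLinearMap.comp_apply, ContinuousLinearMap.flip_apply]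
        using! (hs _ (hmem t ht)).comp_hasDerivAt t (hasDerivAt_add_smul q (z - q) t))
    (by simpa using h0)
  simpa using this

lemma continuousAt_ray {W : Type*} [TopologicalSpace W] {f : B → W} {Ω : Set B} (hΩ : IsOpen Ω)
    (hf : ContinuousOn f Ω) {q h : B} {t : ℝ} (ht : q + t • h ∈ Ω) :
    ContinuousAt (fun t : ℝ ↦ f (q + t • h)) t :=
  ContinuousAt.comp (f := fun t : ℝ ↦ q + t • h) (hf.continuousAt (hΩ.mem_nhds ht))
    (by fun_prop)

/-- The radial equation gives the directional derivatives along rays. -/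
lemma fderiv_ray_eq {m : G →L[ℝ] F →L[ℝ] F} {A : B → B →L[ℝ] G} {Ω : Set B} {q : B}
    (hΩo : IsOpen Ω) (hA : ContinuousOn A Ω) {s : B → F} (hs : ContDiffOn ℝ 1 s Ω)
    (hrad : ∀ z ∈ Ω, fderiv ℝ s z (z - q) = -m (A z (z - q)) (s z)) (h : B) (t : ℝ)
    (ht : q + t • h ∈ Ω) :
    fderiv ℝ s (q + t • h) h = -m (A (q + t • h) h) (s (q + t • h)) := by
  have key : ∀ t : ℝ, t ≠ 0 → q + t • h ∈ Ω →
      fderiv ℝ s (q + t • h) h = -m (A (q + t • h) h) (s (q + t • h)) := by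
    intro t ht0 ht
    have := hrad _ ht
    rw [add_sub_cancel_left, map_smul, map_smul, map_smul, smul_apply, ← smul_neg] at this
    exact smul_right_injective F ht0 this
  -- At `t = 0` the radial equation is empty; the identity is recovered as a limit from `t ≠ 0`.
  rcases eq_or_ne t 0 with rfl | ht0
  swap
  · exact key t ht0 ht
  have hnhds : ∀ᶠ t in 𝓝 (0 : ℝ), q + t • h ∈ Ω :=
    (by fun_prop : Continuous fun t : ℝ ↦ q + t • h).continuousAt.eventually_mem
      (hΩo.mem_nhds ht)
  have h1 : ContinuousAt (fun t : ℝ ↦ fderiv ℝ s (q + t • h) h) 0 :=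
    (continuousAt_ray hΩo (hs.continuousOn_fderiv_of_isOpen hΩo le_rfl) ht).clm_apply continuousAt_const
  have h2 : ContinuousAt (fun t : ℝ ↦ -m (A (q + t • h) h) (s (q + t • h))) 0 :=
    ((m.continuous.continuousAt.comp ((continuousAt_ray hΩo hA ht).clm_apply continuousAt_const)).clm_apply
      (continuousAt_ray hΩo hs.continuousOn ht)).neg
  refine tendsto_nhds_unique_of_eventuallyEq (l := 𝓝[≠] (0 : ℝ))
    (h1.tendsto.mono_left nhdsWithin_le_nhds) (h2.tendsto.mono_left nhdsWithin_le_nhds) ?_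
  filter_upwards [nhdsWithin_le_nhds hnhds, self_mem_nhdsWithin] with t ht1 ht2
  exact key t ht2 ht1

/-- If all covariant derivatives of the curvature at `q` annihilate `s q` and `s` is radially
parallel, then the curvature applied to `s` vanishes to infinite order along rays. -/
lemma isBigO_iterCurv_ray {ad : G →L[ℝ] G →L[ℝ] G} {m : G →L[ℝ] F →L[ℝ] F}
    (hm : ∀ a b f, m (ad a b) f = m a (m b f) - m b (m a f))
    {A : B → B →L[ℝ] G} {Γ : B → B →L[ℝ] B →L[ℝ] B} {U : Set B} {q : B} (hqU : q ∈ U)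
    (hU : IsOpen U) (hA : ContDiffOn ℝ ∞ A U) (hΓ : ContDiffOn ℝ ∞ Γ U) {s : B → F}
    (hs : ContDiffOn ℝ 1 s U)
    (hrad : ∀ z ∈ U, fderiv ℝ s z (z - q) = -m (A z (z - q)) (s z))
    (hq : ∀ (k : ℕ) (v : Fin (k + 2) → B), m (iterCurv ad A Γ k q v) (s q) = 0) (h : B) (n : ℕ) :
    ∀ (k : ℕ) (X : Fin (k + 2) → B → B), (∀ i, ContDiffOn ℝ ∞ (X i) U) →
      (fun t : ℝ ↦ m (iterCurv ad A Γ k (q + t • h) (X · (q + t • h))) (s (q + t • h)))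
        =O[𝓝 0] fun t : ℝ ↦ t ^ n := by
  have hnhds : ∀ᶠ t in 𝓝 (0 : ℝ), q + t • h ∈ U :=
    (by fun_prop : Continuous fun t : ℝ ↦ q + t • h).continuousAt.eventually_mem
      (hU.mem_nhds (by simpa using hqU))
  have hmap : Filter.Tendsto (fun t : ℝ ↦ q + t • h) (𝓝 0) (𝓝 q) := by
    have : Continuous fun t : ℝ ↦ q + t • h := by fun_prop
    simpa using this.tendsto 0
  have hsd : ∀ z ∈ U, DifferentiableAt ℝ s z := fun z hz ↦
    (hs.contDiffAt (hU.mem_nhds hz)).differentiableAt (by simp)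
  have hTd : ∀ k, ∀ z ∈ U, DifferentiableAt ℝ (iterCurv ad A Γ k) z := fun k z hz ↦
    ((contDiffOn_iterCurv hU hA hΓ k).contDiffAt (hU.mem_nhds hz)).differentiableAt (by simp)
  have hXd : ∀ {X : B → B}, ContDiffOn ℝ ∞ X U → ∀ z ∈ U, DifferentiableAt ℝ X z :=
    fun hX z hz ↦ (hX.contDiffAt (hU.mem_nhds hz)).differentiableAt (by simp)
  -- The order is raised for all `k` and all fields at once: differentiating the term at `(k, X)`
  -- along the ray produces one at `k + 1` and others at `k` with a field replaced.
  induction n with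
  | zero =>
    intro k X hX
    have hc : ContinuousAt (fun z ↦ m (iterCurv ad A Γ k z (X · z)) (s z)) q :=
      (m.continuous.continuousAt.comp ((hTd k q hqU).hasFDerivAt.continuousMultilinearMap_apply
        fun i ↦ (hXd (hX i) q hqU).hasFDerivAt).continuousAt).clm_apply (hsd q hqU).continuousAt
    simpa using! (hc.tendsto.comp hmap).isBigO_one ℝ
  | succ n ih =>
    intro k X hX
    -- The covariant derivative of `X i` in the direction `h`, for `d + Γ`.
    let X' : Fin (k + 2) → B → B := fun i z ↦ fderiv ℝ (X i) z h + Γ z h (X i z)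
    have hX' : ∀ i, ContDiffOn ℝ ∞ (X' i) U := fun i ↦
      (((hX i).fderiv_of_isOpen hU (by simp)).clm_apply contDiffOn_const).add
        ((hΓ.clm_apply contDiffOn_const).clm_apply (hX i))
    refine isBigO_pow_succ_of_deriv (g' := fun t ↦
      m (iterCurv ad A Γ (k + 1) (q + t • h)
        ((Fin.cons (fun _ ↦ h) X : Fin (k + 1 + 2) → B → B) · (q + t • h))) (s (q + t • h))
      + ∑ i, m (iterCurv ad A Γ k (q + t • h)
        (Function.update X i (X' i) · (q + t • h))) (s (q + t • h))
      - m (A (q + t • h) h) (m (iterCurv ad A Γ k (q + t • h) (X · (q + t • h)))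
        (s (q + t • h)))) ?_ (by simpa using hq k _) ?_
    · filter_upwards [hnhds] with t ht
      have hQ := ((hTd k _ ht).hasFDerivAt.continuousMultilinearMap_apply
        fun i ↦ (hXd (hX i) _ ht).hasFDerivAt)
      have hd := ((m.hasFDerivAt.comp _ hQ.differentiableAt.hasFDerivAt).clm_apply
        (hsd _ ht).hasFDerivAt).comp_hasDerivAt t (hasDerivAt_add_smul q h t)
      refine hd.congr_deriv ?_
      have hform := fderiv_tensor_apply ad A Γ (hTd k _ ht) (fun i ↦ hXd (hX i) _ ht) h
      have hray := fderiv_ray_eq hU hA.continuousOn hs hrad h t ht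
      have e1 : (fun i ↦ (Fin.cons (fun _ ↦ h) X : Fin (k + 1 + 2) → B → B) i (q + t • h))
          = Fin.cons h (X · (q + t • h)) := by
        ext i; refine Fin.cases ?_ (fun j ↦ ?_) i <;> simp
      have e2 : ∀ i, (fun j ↦ Function.update X i (X' i) j (q + t • h))
          = Function.update (X · (q + t • h)) i (X' i (q + t • h)) := by
        intro i; ext j; rcases eq_or_ne j i with rfl | hj
        · simp
        · simp [hj]
      simp only [e1, e2]
      rw [iterCurv_succ]
      have hform' := congrArg (fun Q ↦ m Q (s (q + t • h))) hform
      simp only [map_add, add_apply, hm, map_sum, sum_apply] at hform'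
      simp only [add_apply, ContinuousLinearMap.comp_apply, ContinuousLinearMap.flip_apply,
        ContinuousLinearMap.flip_apply, Function.comp_apply]
      rw [hray]
      simp only [map_neg]
      linear_combination (norm := module) hform'
    · have hY : ∀ i, ContDiffOn ℝ ∞ ((Fin.cons (fun _ ↦ h) X : Fin (k + 1 + 2) → B → B) i) U := by
        intro i
        refine Fin.cases ?_ (fun j ↦ ?_) i
        · simpa using contDiffOn_const
        · simpa using hX j
      have hZ : ∀ i j, ContDiffOn ℝ ∞ (Function.update X i (X' i) j) U := by
        intro i j
        rcases eq_or_ne j i with rfl | hj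
        · simpa using hX' j
        · simpa [hj] using hX j
      have hc : ContinuousAt (fun z ↦ m (A z h)) q :=
        m.continuous.continuousAt.comp
          ((hA.continuousOn.continuousAt (hU.mem_nhds hqU)).clm_apply continuousAt_const)
      have hO := ((hc.tendsto.comp hmap).isBigO_one ℝ).norm_left.mul (ih k X hX).norm_left
      have h3 : (fun t : ℝ ↦ m (A (q + t • h) h)
          (m (iterCurv ad A Γ k (q + t • h) (X · (q + t • h))) (s (q + t • h))))
          =O[𝓝 0] fun t : ℝ ↦ t ^ n := by
        refine (Asymptotics.IsBigO.of_norm_le fun t ↦ ?_).trans (by simpa using hO)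
        exact ContinuousLinearMap.le_opNorm _ _
      exact ((ih (k + 1) _ hY).add
        (Asymptotics.IsBigO.fun_sum fun i _ ↦ ih k (Function.update X i (X' i)) (hZ i))).sub h3

/-- A radially parallel section is parallel if all covariant derivatives of the curvature at the
centre annihilate its value there, provided that everything is analytic. -/
theorem parallel_of_radial [CompleteSpace F] [CompleteSpace G]
    {ad : G →L[ℝ] G →L[ℝ] G} {m : G →L[ℝ] F →L[ℝ] F}
    (hm : ∀ a b f, m (ad a b) f = m a (m b f) - m b (m a f))
    {A : B → B →L[ℝ] G} {Γ : B → B →L[ℝ] B →L[ℝ] B} {U Ω : Set B} {q : B} (hqU : q ∈ U)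
    (hU : IsOpen U) (hΓ : ContDiffOn ℝ ∞ Γ U) (hΩo : IsOpen Ω) (hqΩ : q ∈ Ω)
    (hΩ : StarConvex ℝ q Ω) (hA : ContDiffOn ℝ ω A Ω) {s : B → F} (hs : ContDiffOn ℝ ω s Ω)
    (hrad : ∀ z ∈ Ω, fderiv ℝ s z (z - q) = -m (A z (z - q)) (s z))
    (hq : ∀ (k : ℕ) (v : Fin (k + 2) → B), m (iterCurv ad A Γ k q v) (s q) = 0) :
    ∀ z ∈ Ω, HasFDerivAt s (-(m.flip (s z)).comp (A z)) z := by
  -- The curvature applied to `s` is analytic in `t` and flat at `t = 0`, hence zero on the ray.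
  -- Flatness is local, so it is enough to have `Γ` smooth on `U ∩ Ω`.
  have hcurv : ∀ h : B, q + h ∈ Ω → ∀ w : B, ∀ t ∈ Icc (0 : ℝ) 1,
      m (curv ad A (q + t • h) h w) (s (q + t • h)) = 0 := by
    intro h hh w
    have hmem : ∀ t ∈ Icc (0 : ℝ) 1, q + t • h ∈ Ω := fun t ht ↦ hΩ.add_smul_mem hh ht.1 ht.2
    have hS : IsOpen ((fun t : ℝ ↦ q + t • h) ⁻¹' Ω) := hΩo.preimage (by fun_prop)
    have hray : ContDiff ℝ ω (fun t : ℝ ↦ q + t • h) := by fun_prop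
    have hmaps : MapsTo (fun t : ℝ ↦ q + t • h) ((fun t : ℝ ↦ q + t • h) ⁻¹' Ω) Ω := fun _ h ↦ h
    have hf : ContDiffOn ℝ ω (fun t : ℝ ↦ m (curv ad A (q + t • h) h w) (s (q + t • h)))
        ((fun t : ℝ ↦ q + t • h) ⁻¹' Ω) :=
      (m.contDiff.comp_contDiffOn (((contDiffOn_curv hΩo (m := ω) (n := ω) (by simp) hA).comp
        hray.contDiffOn hmaps |>.clm_apply contDiffOn_const).clm_apply contDiffOn_const)).clm_apply
          (hs.comp hray.contDiffOn hmaps)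
    have hfa : AnalyticOnNhd ℝ (fun t : ℝ ↦ m (curv ad A (q + t • h) h w) (s (q + t • h)))
        (Icc 0 1) := fun t ht ↦
      (hS.analyticOn_iff_analyticOnNhd.1 hf.analyticOn) t (hmem t ht)
    refine hfa.eqOn_zero_of_preconnected_of_eventuallyEq_zero isPreconnected_Icc (z₀ := 0)
      (by simp) (eventually_eq_zero_of_isBigO_pow (hfa 0 (by simp)) fun n ↦ ?_)
    have hsub : U ∩ Ω ⊆ Ω := inter_subset_right
    simpa [iterCurv_zero_apply] using isBigO_iterCurv_ray hm (U := U ∩ Ω) ⟨hqU, hqΩ⟩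
      (hU.inter hΩo) ((hA.of_le le_top).mono hsub) (hΓ.mono inter_subset_left)
      ((hs.of_le le_top).mono hsub) (fun z hz ↦ hrad z hz.2) hq h n 0 ![fun _ ↦ h, fun _ ↦ w]
      (by intro i; fin_cases i <;> exact contDiffOn_const)
  have hdA : ∀ z ∈ Ω, HasFDerivAt A (fderiv ℝ A z) z := fun z hz ↦
    ((hA.contDiffAt (hΩo.mem_nhds hz)).differentiableAt (by simp)).hasFDerivAt
  have hds : ∀ z ∈ Ω, HasFDerivAt s (fderiv ℝ s z) z := fun z hz ↦
    ((hs.contDiffAt (hΩo.mem_nhds hz)).differentiableAt (by simp)).hasFDerivAt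
  have hdds : ∀ z ∈ Ω, HasFDerivAt (fderiv ℝ s) (fderiv ℝ (fderiv ℝ s) z) z := fun z hz ↦
    (((hs.fderiv_of_isOpen hΩo (m := ω) (by simp)).contDiffAt
      (hΩo.mem_nhds hz)).differentiableAt (by simp)).hasFDerivAt
  -- The full covariant derivative of `s`; its radial component vanishes by `hrad`, and the aim is
  -- `ψ = 0`.
  let ψ : B → B →L[ℝ] F := fun z ↦ fderiv ℝ s z + (m.flip (s z)).comp (A z)
  let ψ' : B → B →L[ℝ] B →L[ℝ] F := fun z ↦ fderiv ℝ ψ z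
  have hψ : ∀ z ∈ Ω, HasFDerivAt ψ (ψ' z) z := fun z hz ↦
    ((hdds z hz).add ((m.flip.hasFDerivAt.comp z (hds z hz)).clm_comp
      (hdA z hz))).differentiableAt.hasFDerivAt
  have hψ' : ∀ z ∈ Ω, ∀ a b, ψ' z a b = fderiv ℝ (fderiv ℝ s) z a b
      + m (A z b) (fderiv ℝ s z a) + m (fderiv ℝ A z a b) (s z) := by
    intro z hz a b
    have := ((hdds z hz).add ((m.flip.hasFDerivAt.comp z (hds z hz)).clm_comp (hdA z hz))).fderiv
    have h2 : ψ' z = _ := this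
    rw [h2]
    simp
    abel
  have hsymm : ∀ z ∈ Ω, ∀ a b, fderiv ℝ (fderiv ℝ s) z a b = fderiv ℝ (fderiv ℝ s) z b a :=
    fun z hz ↦ second_derivative_symmetric_of_eventually
      (Filter.eventually_of_mem (hΩo.mem_nhds hz) hds) (hdds z hz)
  have hψrad : ∀ z ∈ Ω, ψ z (z - q) = 0 := fun z hz ↦ by simp [ψ, hrad z hz]
  have hψrad' : ∀ z ∈ Ω, ∀ w, ψ' z w (z - q) + ψ z w = 0 := by
    intro z hz w
    have h1 := (hψ z hz).clm_apply ((hasFDerivAt_id z).sub_const q)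
    have h2 : HasFDerivAt (fun z ↦ ψ z (id z - q)) (0 : B →L[ℝ] F) z :=
      (hasFDerivAt_const (0 : F) z).congr_of_eventuallyEq
        (Filter.eventually_of_mem (hΩo.mem_nhds hz) hψrad)
    have := congrArg (fun L ↦ L w) (h1.unique h2)
    simp at this
    rw [add_comm]
    simpa using this
  have hψ0 : ∀ z ∈ Ω, ∀ w, ψ z w = 0 := by
    intro z hz w
    set h := z - q with hh
    have hzq : q + h = z := by simp [hh]
    have hmem : ∀ t ∈ Icc (0 : ℝ) 1, q + t • h ∈ Ω := fun t ht ↦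
      hΩ.add_smul_mem (hzq ▸ hz) ht.1 ht.2
    have hcont : ContinuousOn (fun t : ℝ ↦ A (q + t • h)) (Icc 0 1) :=
      hA.continuousOn.comp (by fun_prop) hmem
    -- The factor `t` makes the initial value `0` and absorbs the term `ψ z w` coming from the
    -- derivative of `ψ z (z - q) = 0`; what remains is a homogeneous linear equation.
    have := eq_zero_of_hasDerivAt_linear (g := fun t : ℝ ↦ t • ψ (q + t • h) w)
      (c := fun t ↦ -m (A (q + t • h) h))
      (m.continuous.comp_continuousOn (hcont.clm_apply continuousOn_const)).neg (fun t ht ↦ ?_)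
      (by simp)
    · simpa [hzq] using this
    · have hΩt := hmem t ht
      have hd := (hasDerivAt_id t).smul (((hψ _ hΩt).clm_apply
        (hasFDerivAt_const w _)).comp_hasDerivAt t (hasDerivAt_add_smul q h t))
      refine hd.congr_deriv ?_
      have e1 := hψrad' _ hΩt w
      rw [add_sub_cancel_left, map_smul] at e1
      have e2 := fderiv_ray_eq hΩo hA.continuousOn (hs.of_le le_top) hrad h t hΩt
      have e3 := hcurv h (hzq ▸ hz) w t ht
      rw [curv_apply] at e3
      simp only [map_add, map_sub, add_apply, sub_apply, hm] at e3
      have e4 : fderiv ℝ s (q + t • h) w =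
        ψ (q + t • h) w - m (A (q + t • h) w) (s (q + t • h)) := by simp [ψ]
      -- The structure equation `dψ + A ∧ ψ = R s` on the pair `(h, w)`, where both `R(h, w)s` and
      -- `ψ h` vanish.
      have e5 : ψ' (q + t • h) h w = ψ' (q + t • h) w h
          - m (A (q + t • h) h) (ψ (q + t • h) w) := by
        rw [hψ' _ hΩt, hψ' _ hΩt, hsymm _ hΩt, e2, e4]
        simp only [map_sub, map_neg]
        linear_combination (norm := module) e3
      simp only [id, add_apply, ContinuousLinearMap.comp_apply, ContinuousLinearMap.flip_apply,
        zero_apply, map_zero, zero_add, Function.comp_apply, neg_apply, map_smul, e5]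
      linear_combination (norm := module) e1
  intro z hz
  refine (hds z hz).congr_fderiv ?_
  ext w
  have := hψ0 z hz w
  simp only [ψ, add_apply, ContinuousLinearMap.comp_apply, ContinuousLinearMap.flip_apply] at this
  simpa using eq_neg_of_add_eq_zero_left this

end ConnectionForm

/-! ### Radially parallel sections -/

section PathSpace

variable {B F G W : Type*} [NormedAddCommGroup B] [NormedSpace ℝ B]
  [NormedAddCommGroup F] [NormedSpace ℝ F] [NormedAddCommGroup G] [NormedSpace ℝ G]
  [NormedAddCommGroup W] [NormedSpace ℝ W]

lemma continuous_projIcc_apply (m : G →L[ℝ] F →L[ℝ] F) (g : C(unitInterval, G))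
    (u : C(unitInterval, F)) : Continuous fun τ : ℝ ↦
      m (g (projIcc 0 1 zero_le_one τ)) (u (projIcc 0 1 zero_le_one τ)) :=
  (m.continuous.comp (g.continuous.comp continuous_projIcc)).clm_apply
    (u.continuous.comp continuous_projIcc)

lemma norm_integral_projIcc_le (m : G →L[ℝ] F →L[ℝ] F) (g : C(unitInterval, G))
    (u : C(unitInterval, F)) (t : unitInterval) : ‖∫ τ in (0 : ℝ)..t,
      m (g (projIcc 0 1 zero_le_one τ)) (u (projIcc 0 1 zero_le_one τ))‖ ≤ ‖m‖ * ‖g‖ * ‖u‖ := by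
  refine (intervalIntegral.norm_integral_le_of_norm_le_const
    (C := ‖m‖ * ‖g‖ * ‖u‖) fun τ _ ↦ ?_).trans ?_
  · exact (m.le_opNorm₂ _ _).trans (by gcongr <;> exact ContinuousMap.norm_coe_le_norm _ _)
  · refine mul_le_of_le_one_right (by positivity) ?_
    rw [sub_zero, abs_of_nonneg t.2.1]
    exact t.2.2

/-- The Volterra operator `(g, u) ↦ (t ↦ ∫₀ᵗ g(τ) u(τ) dτ)`. -/
noncomputable def volterra (m : G →L[ℝ] F →L[ℝ] F) :
    C(unitInterval, G) →L[ℝ] C(unitInterval, F) →L[ℝ] C(unitInterval, F) :=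
  LinearMap.mkContinuous₂
    (LinearMap.mk₂ ℝ (fun g u ↦
      (⟨fun t ↦ ∫ τ in (0 : ℝ)..t,
        m (g (projIcc 0 1 zero_le_one τ)) (u (projIcc 0 1 zero_le_one τ)),
        (intervalIntegral.continuous_primitive (fun a b ↦
          (continuous_projIcc_apply m g u).intervalIntegrable a b) 0).comp
            continuous_subtype_val⟩ : C(unitInterval, F)))
      (fun g g' u ↦ by
        ext t
        simp only [ContinuousMap.coe_mk, ContinuousMap.add_apply, map_add, add_apply]
        exact intervalIntegral.integral_add
          ((continuous_projIcc_apply m g u).intervalIntegrable _ _)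
          ((continuous_projIcc_apply m g' u).intervalIntegrable _ _))
      (fun c g u ↦ by
        ext t
        simp only [ContinuousMap.coe_mk, ContinuousMap.smul_apply, map_smul, smul_apply]
        exact intervalIntegral.integral_smul _ _)
      (fun g u u' ↦ by
        ext t
        simp only [ContinuousMap.coe_mk, ContinuousMap.add_apply, map_add]
        exact intervalIntegral.integral_add
          ((continuous_projIcc_apply m g u).intervalIntegrable _ _)
          ((continuous_projIcc_apply m g u').intervalIntegrable _ _))
      (fun c g u ↦ by
        ext t
        simp only [ContinuousMap.coe_mk, ContinuousMap.smul_apply, map_smul]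
        exact intervalIntegral.integral_smul _ _)) ‖m‖ (fun g u ↦ by
      rw [ContinuousMap.norm_le _ (by positivity)]
      exact norm_integral_projIcc_le m g u)

lemma volterra_apply (m : G →L[ℝ] F →L[ℝ] F) (g : C(unitInterval, G)) (u : C(unitInterval, F))
    (t : unitInterval) : volterra m g u t = ∫ τ in (0 : ℝ)..t,
      m (g (projIcc 0 1 zero_le_one τ)) (u (projIcc 0 1 zero_le_one τ)) := rfl

lemma norm_volterra_le (m : G →L[ℝ] F →L[ℝ] F) (g : C(unitInterval, G)) :
    ‖volterra m g‖ ≤ ‖m‖ * ‖g‖ := by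
  refine ContinuousLinearMap.opNorm_le_bound _ (by positivity) fun u ↦ ?_
  rw [ContinuousMap.norm_le _ (by positivity)]
  exact norm_integral_projIcc_le m g u

set_option synthInstance.maxHeartbeats 200000 in
/-- Pointwise evaluation of a path of linear maps at a vector. -/
noncomputable def evalPath (B G : Type*) [NormedAddCommGroup B] [NormedSpace ℝ B]
    [NormedAddCommGroup G] [NormedSpace ℝ G] :
    C(unitInterval, B →L[ℝ] G) →L[ℝ] B →L[ℝ] C(unitInterval, G) :=
  LinearMap.mkContinuous₂
    (LinearMap.mk₂ ℝ (fun (α : C(unitInterval, B →L[ℝ] G)) (h : B) ↦ (⟨fun τ ↦ α τ h, by fun_prop⟩ : C(unitInterval, G)))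
      (fun α α' h ↦ rfl) (fun c α h ↦ rfl) (fun α h h' ↦ by ext; simp)
      (fun c α h ↦ by ext; simp)) 1 (fun α h ↦ by
      rw [ContinuousMap.norm_le _ (by positivity)]
      intro τ
      rw [one_mul]
      exact (α τ).le_of_opNorm_le (ContinuousMap.norm_coe_le_norm _ _) _)

lemma evalPath_apply (α : C(unitInterval, B →L[ℝ] G)) (h : B) (τ : unitInterval) :
    evalPath B G α h τ = α τ h := rfl

/-- Multiplication by the function `τ ↦ τ ^ n` as a map from constants to paths. -/
noncomputable def powPath (W : Type*) [NormedAddCommGroup W] [NormedSpace ℝ W] (n : ℕ) :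
    W →L[ℝ] C(unitInterval, W) :=
  LinearMap.mkContinuous
    { toFun := fun w ↦ ⟨fun τ ↦ (τ : ℝ) ^ n • w, by fun_prop⟩
      map_add' := fun w w' ↦ by ext; simp
      map_smul' := fun c w ↦ by ext τ; exact smul_comm _ _ _ } 1 (fun w ↦ by
      rw [ContinuousMap.norm_le _ (by positivity)]
      intro τ
      simp only [LinearMap.coe_mk, AddHom.coe_mk, ContinuousMap.coe_mk, norm_smul]
      gcongr
      rw [norm_pow, Real.norm_eq_abs, abs_of_nonneg τ.2.1]
      exact pow_le_one₀ τ.2.1 τ.2.2)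

lemma powPath_apply (n : ℕ) (w : W) (τ : unitInterval) :
    powPath W n w τ = (τ : ℝ) ^ n • w := rfl

lemma norm_powPath_le (n : ℕ) : ‖powPath W n‖ ≤ 1 :=
  LinearMap.mkContinuous_norm_le _ zero_le_one _

/-- The restrictions of an analytic function to the segments from the centre of a ball of
convergence depend analytically on the endpoint. -/
theorem exists_analyticOnNhd_segment [CompleteSpace W] {A : B → W}
    {p : FormalMultilinearSeries ℝ B W} {q : B} {r : ENNReal} (hA : HasFPowerSeriesOnBall A p q r) :
    ∃ α : B → C(unitInterval, W), AnalyticOnNhd ℝ α (Metric.eball 0 r) ∧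
      ∀ h ∈ Metric.eball (0 : B) r, ∀ τ : unitInterval, α h τ = A (q + (τ : ℝ) • h) := by
  -- Since `A (q + τ h) = ∑ τ ^ n p_n(h, …, h)` and `τ ^ n ≤ 1`, multiplying the `n`-th coefficient
  -- by the path `τ ^ n` does not shrink the radius.
  let b : FormalMultilinearSeries ℝ B C(unitInterval, W) :=
    fun n ↦ (powPath W n).compContinuousMultilinearMap (p n)
  have hb : r ≤ b.radius := hA.r_le.trans (FormalMultilinearSeries.radius_le_of_le fun n ↦
    ((powPath W n).norm_compContinuousMultilinearMap_le (p n)).trans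
      (mul_le_of_le_one_left (norm_nonneg _) (norm_powPath_le n)))
  have hs := (b.hasFPowerSeriesOnBall (hA.r_pos.trans_le hb)).mono hA.r_pos hb
  refine ⟨b.sum, hs.analyticOnNhd, fun h hh τ ↦ ?_⟩
  have h1 := (hs.hasSum hh).mapL (ContinuousMap.evalCLM ℝ τ)
  have hτ : (τ : ℝ) • h ∈ Metric.eball (0 : B) r := by
    rw [Metric.mem_eball, edist_zero_right] at hh ⊢
    refine lt_of_le_of_lt ?_ hh
    rw [enorm_smul]
    refine mul_le_of_le_one_left (by positivity) ?_
    rw [Real.enorm_eq_ofReal τ.2.1]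
    exact ENNReal.ofReal_le_one.2 τ.2.2
  have h2 := hA.hasSum hτ
  rw [zero_add] at h1
  refine h1.unique ?_
  convert h2 using 2 with n
  simp only [b, ContinuousMap.evalCLM_apply, ContinuousLinearMap.compContinuousMultilinearMap_coe,
    Function.comp_apply, powPath_apply]
  rw [(p n).map_smul_univ]
  simp

end PathSpace

namespace ConnectionForm

variable {B F G : Type*} [NormedAddCommGroup B] [NormedSpace ℝ B]
  [NormedAddCommGroup F] [NormedSpace ℝ F] [NormedAddCommGroup G] [NormedSpace ℝ G]

lemma isUnit_one_sub_neg_of_norm_lt_one {E : Type*} [NormedAddCommGroup E] [NormedSpace ℝ E]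
    [CompleteSpace E] {T : E →L[ℝ] E} (hT : ‖T‖ < 1) : IsUnit (1 - -T) :=
  isUnit_one_sub_of_norm_lt_one (by rwa [norm_neg])

lemma contDiffOn_clm {X Y Z : Type*} [NormedAddCommGroup X] [NormedSpace ℝ X]
    [NormedAddCommGroup Y] [NormedSpace ℝ Y] [NormedAddCommGroup Z] [NormedSpace ℝ Z] {n : ℕ∞ω}
    (L : Y →L[ℝ] Z) {f : X → Y} {s : Set X} (hf : ContDiffOn ℝ n f s) :
    ContDiffOn ℝ n (fun x ↦ L (f x)) s := L.contDiff.comp_contDiffOn hf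

lemma contDiffOn_clm₂ {X Y Y' Z : Type*} [NormedAddCommGroup X] [NormedSpace ℝ X]
    [NormedAddCommGroup Y] [NormedSpace ℝ Y] [NormedAddCommGroup Y'] [NormedSpace ℝ Y']
    [NormedAddCommGroup Z] [NormedSpace ℝ Z] {n : ℕ∞ω}
    (L : Y →L[ℝ] Y' →L[ℝ] Z) {f : X → Y} {g : X → Y'} {s : Set X} (hf : ContDiffOn ℝ n f s)
    (hg : ContDiffOn ℝ n g s) :
    ContDiffOn ℝ n (fun x ↦ L (f x) (g x)) s := (contDiffOn_clm L hf).clm_apply hg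

/-- Inversion is analytic on the units of the Banach algebra of operators; this is the source of
analytic dependence of solutions on the ray. -/
lemma contDiffOn_inverse_one_sub_neg {X E : Type*} [NormedAddCommGroup X] [NormedSpace ℝ X]
    [NormedAddCommGroup E] [NormedSpace ℝ E] [CompleteSpace E] {T : X → E →L[ℝ] E} {s : Set X}
    {n : ℕ∞ω} (hT : ContDiffOn ℝ n T s) (hu : ∀ x ∈ s, IsUnit (1 - -T x)) (v : E) :
    ContDiffOn ℝ n (fun x ↦ Ring.inverse (1 - -T x) v) s := by
  refine ContDiffOn.clm_apply (fun x hx ↦ ?_) contDiffOn_const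
  obtain ⟨y, hy⟩ := hu x hx
  have h4 := contDiffAt_ringInverse ℝ (n := n) y
  rw [hy] at h4
  exact h4.comp_contDiffWithinAt (f := fun x ↦ 1 - -T x) x ((contDiffOn_const.sub hT.neg) x hx)

set_option synthInstance.maxHeartbeats 200000 in
lemma contDiffOn_volterra {X : Type*} [NormedAddCommGroup X] [NormedSpace ℝ X] {n : ℕ∞ω}
    (m : G →L[ℝ] F →L[ℝ] F) {a : X → C(unitInterval, G)} {s : Set X} (ha : ContDiffOn ℝ n a s) :
    ContDiffOn ℝ n (fun h ↦ volterra m (a h)) s :=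
  contDiffOn_clm (Z := C(unitInterval, F) →L[ℝ] C(unitInterval, F)) (volterra m) ha

set_option synthInstance.maxHeartbeats 200000 in
set_option maxHeartbeats 1000000 in
/-- Existence of radially parallel sections. -/
theorem exists_radial_of_hasFPowerSeriesOnBall [CompleteSpace F] [CompleteSpace G]
    (m : G →L[ℝ] F →L[ℝ] F)
    {A : B → B →L[ℝ] G} {p : FormalMultilinearSeries ℝ B (B →L[ℝ] G)} {q : B} {ρ C : ℝ}
    (hA : HasFPowerSeriesOnBall A p q (ENNReal.ofReal ρ)) 
    (hC : ∀ z ∈ Metric.ball q ρ, ‖A z‖ ≤ C) (hCρ : ‖m‖ * (C * ρ) < 1) (f : F) :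
    ∃ s : B → F, ContDiffOn ℝ ω s (Metric.ball q ρ) ∧ s q = f ∧
      ∀ z ∈ Metric.ball q ρ, fderiv ℝ s z (z - q) = -m (A z (z - q)) (s z) := by
  obtain ⟨α, hα, hαA⟩ := exists_analyticOnNhd_segment hA
  rw [Metric.eball_ofReal] at hα hαA
  have hρ : 0 < ρ := by simpa using hA.r_pos
  have hC0 : 0 ≤ C := (norm_nonneg _).trans (hC q (Metric.mem_ball_self hρ))
  let a : B → C(unitInterval, G) := fun h ↦ evalPath B G (α h) h
  have ha_apply : ∀ h ∈ Metric.ball (0 : B) ρ, ∀ τ : unitInterval,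
      a h τ = A (q + (τ : ℝ) • h) h := fun h hh τ ↦ by
    simp only [a, evalPath_apply, hαA h hh]
  have hball : ∀ h ∈ Metric.ball (0 : B) ρ, ∀ t ∈ Icc (0 : ℝ) 1, t • h ∈ Metric.ball (0 : B) ρ :=
    fun h hh t ht ↦ by
      simpa using ((convex_ball (0 : B) ρ).starConvex (Metric.mem_ball_self hρ)).smul_mem hh
        ht.1 ht.2
  have hmem : ∀ h ∈ Metric.ball (0 : B) ρ, q + h ∈ Metric.ball q ρ := fun h hh ↦ by simpa using hh
  have ha_norm : ∀ h ∈ Metric.ball (0 : B) ρ, ‖a h‖ ≤ C * ρ := by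
    intro h hh
    rw [ContinuousMap.norm_le _ (by positivity)]
    intro τ
    rw [ha_apply h hh]
    have : ‖h‖ ≤ ρ := (mem_ball_zero_iff.1 hh).le
    exact ((A _).le_of_opNorm_le (hC _ (hmem _ (hball h hh τ τ.2))) h).trans (by gcongr)
  -- In integral form `u' = -a u`, `u 0 = f` reads `(1 + volterra m a) u = f`; `hCρ` makes the
  -- perturbation of norm less than `1`.
  let S : B → C(unitInterval, F) →L[ℝ] C(unitInterval, F) := fun h ↦ 1 - -volterra m (a h)
  have hS : ∀ h ∈ Metric.ball (0 : B) ρ, IsUnit (S h) := fun h hh ↦ by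
    have : ‖volterra m (a h)‖ < 1 := by
      refine (norm_volterra_le m (a h)).trans_lt (lt_of_le_of_lt ?_ hCρ)
      exact mul_le_mul_of_nonneg_left (ha_norm h hh) (norm_nonneg m)
    exact isUnit_one_sub_neg_of_norm_lt_one this
  let u : B → C(unitInterval, F) := fun h ↦ Ring.inverse (S h) (ContinuousMap.const _ f)
  have hSu : ∀ h ∈ Metric.ball (0 : B) ρ, ∀ w : C(unitInterval, F),
      S h w = ContinuousMap.const _ f → w = u h := by
    intro h hh w hw
    have := congrArg (fun L : C(unitInterval, F) →L[ℝ] C(unitInterval, F) ↦ L w)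
      (Ring.inverse_mul_cancel (S h) (hS h hh))
    simp only [u, ← hw]
    exact this.symm
  have hu : ∀ h ∈ Metric.ball (0 : B) ρ, ∀ t : unitInterval, u h t = f - ∫ τ in (0 : ℝ)..t,
      m (a h (projIcc 0 1 zero_le_one τ)) (u h (projIcc 0 1 zero_le_one τ)) := by
    intro h hh t
    have := congrArg (fun L : C(unitInterval, F) →L[ℝ] C(unitInterval, F) ↦
      L (ContinuousMap.const _ f) t) (Ring.mul_inverse_cancel (S h) (hS h hh))
    have h2 : u h t + volterra m (a h) (u h) t = f := by
      simpa [S, u] using! this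
    rw [eq_sub_iff_add_eq, ← volterra_apply]
    exact h2
  -- By uniqueness, the solution along `t h` is the solution along `h` run at speed `t`. Hence `z ↦
  -- u (z - q) 1` restricts on each ray to the solution on that ray.
  have hscale : ∀ h ∈ Metric.ball (0 : B) ρ, ∀ t : unitInterval, u ((t : ℝ) • h) 1 = u h t := by
    intro h hh t
    have hth := hball h hh t t.2
    let w : C(unitInterval, F) := ⟨fun τ ↦ u h (t * τ), by fun_prop⟩
    have hw : w = u ((t : ℝ) • h) := by
      refine hSu _ hth w ?_
      ext τ
      have e1 : S ((t : ℝ) • h) w τ = w τ + volterra m (a ((t : ℝ) • h)) w τ := by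
        simp [S]
      rw [e1, volterra_apply]
      have e2 : w τ = u h (t * τ) := rfl
      rw [e2, hu h hh, ContinuousMap.const_apply, sub_add_eq_add_sub, sub_eq_iff_eq_add]
      congr 1
      have e3 := intervalIntegral.smul_integral_comp_mul_left (a := 0) (b := (τ : ℝ)) (fun σ ↦
        m (a h (projIcc 0 1 zero_le_one σ)) (u h (projIcc 0 1 zero_le_one σ))) (t : ℝ)
      rw [mul_zero] at e3
      rw [Set.Icc.coe_mul, ← e3, ← intervalIntegral.integral_smul]
      refine intervalIntegral.integral_congr fun σ hσ ↦ ?_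
      rw [uIcc_of_le τ.2.1] at hσ
      have hσ1 : σ ∈ Icc (0 : ℝ) 1 := ⟨hσ.1, hσ.2.trans τ.2.2⟩
      have htσ : (t : ℝ) * σ ∈ Icc (0 : ℝ) 1 :=
        ⟨mul_nonneg t.2.1 hσ1.1, mul_le_one₀ t.2.2 hσ1.1 hσ1.2⟩
      simp only [projIcc_of_mem _ hσ1, projIcc_of_mem _ htσ, ha_apply _ hth, ha_apply _ hh]
      simp only [map_smul, smul_apply, smul_smul, w, ContinuousMap.coe_mk, mul_comm σ]
      rfl
    rw [← hw]
    simp [w]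
  have hu_an : ContDiffOn ℝ ω u (Metric.ball 0 ρ) := by
    have h1 : ContDiffOn ℝ ω α (Metric.ball 0 ρ) :=
      hα.contDiffOn Metric.isOpen_ball.uniqueDiffOn
    have h2 : ContDiffOn ℝ ω a (Metric.ball 0 ρ) :=
      contDiffOn_clm₂ (evalPath B G) h1 contDiffOn_id
    have h3 : ContDiffOn ℝ ω (fun h ↦ volterra m (a h)) (Metric.ball 0 ρ) :=
      contDiffOn_volterra m h2
    exact contDiffOn_inverse_one_sub_neg (T := fun h ↦ volterra m (a h)) h3 hS _
  have hs : ContDiffOn ℝ ω (fun z ↦ u (z - q) 1) (Metric.ball q ρ) := by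
    refine contDiffOn_clm (ContinuousMap.evalCLM ℝ (1 : unitInterval))
      (hu_an.comp (contDiffOn_id.sub contDiffOn_const) fun z hz ↦ ?_)
    simpa [dist_eq_norm] using hz
  refine ⟨fun z ↦ u (z - q) 1, hs, ?_, fun z hz ↦ ?_⟩
  · have h0 : (0 : B) ∈ Metric.ball (0 : B) ρ := Metric.mem_ball_self hρ
    have := hscale 0 h0 0
    simp only [smul_zero] at this
    simp only [sub_self]
    rw [this, hu 0 h0]
    simp
  · have hzq : z - q ∈ Metric.ball (0 : B) ρ := by simpa [dist_eq_norm] using hz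
    set h := z - q with hh
    let φ : ℝ → F := fun τ ↦
      m (a h (projIcc 0 1 zero_le_one τ)) (u h (projIcc 0 1 zero_le_one τ))
    have hφ : Continuous φ := continuous_projIcc_apply m (a h) (u h)
    have hd1 : HasDerivAt (fun t : ℝ ↦ f - ∫ τ in (0 : ℝ)..t, φ τ) (-φ 1) 1 :=
      (intervalIntegral.integral_hasDerivAt_right (hφ.intervalIntegrable _ _)
        hφ.stronglyMeasurable.stronglyMeasurableAtFilter hφ.continuousAt).const_sub f
    have hd2 : HasDerivAt (fun t : ℝ ↦ u ((q + t • h) - q) 1)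
        (fderiv ℝ (fun z ↦ u (z - q) 1) z h) 1 := by
      have e : z = q + (1 : ℝ) • h := by simp [hh]
      have := ((hs.contDiffAt (Metric.isOpen_ball.mem_nhds hz)).differentiableAt
        (by simp)).hasFDerivAt
      rw [e] at this ⊢
      exact this.comp_hasDerivAt (1 : ℝ) (hasDerivAt_add_smul q h 1)
    -- The two functions of `t` are known to agree only on `[0, 1]`, so derivatives at `1` are
    -- compared within that interval.
    have hd3 : HasDerivWithinAt (fun t : ℝ ↦ f - ∫ τ in (0 : ℝ)..t, φ τ)
        (fderiv ℝ (fun z ↦ u (z - q) 1) z h) (Icc 0 1) 1 := by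
      refine hd2.hasDerivWithinAt.congr (fun t ht ↦ ?_) ?_
      · rw [add_sub_cancel_left, hscale h hzq ⟨t, ht⟩, hu h hzq]
      · have := hscale h hzq 1
        rw [add_sub_cancel_left]
        rw [Set.Icc.coe_one] at this
        rw [this, hu h hzq]
        rfl
    have := (uniqueDiffOn_Icc_zero_one 1 (by simp)).eq_deriv _ hd3 hd1.hasDerivWithinAt
    rw [this]
    have h1 : (1 : ℝ) ∈ Icc (0 : ℝ) 1 := by simp
    have e : z = q + (1 : ℝ) • h := by simp [hh]
    simp only [φ, projIcc_of_mem _ h1, ha_apply h hzq, ← e]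
    rfl

end ConnectionForm

/-! ### Parallel sections on balls of uniform radius -/

namespace ConnectionForm

variable {B F G : Type*} [NormedAddCommGroup B] [NormedSpace ℝ B]
  [NormedAddCommGroup F] [NormedSpace ℝ F] [NormedAddCommGroup G] [NormedSpace ℝ G]

/-- Near a point where the connection form is analytic, a vector annihilated by all covariant
derivatives of the curvature extends to a parallel section on a ball of uniform size. -/
theorem exists_parallel_of_analyticAt [CompleteSpace F] [CompleteSpace G]
    {ad : G →L[ℝ] G →L[ℝ] G} {m : G →L[ℝ] F →L[ℝ] F}
    (hm : ∀ a b f, m (ad a b) f = m a (m b f) - m b (m a f))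
    {A : B → B →L[ℝ] G} {p : B} (hA : AnalyticAt ℝ A p) {U : Set B} (hU : U ∈ 𝓝 p) :
    ∃ ρ > 0, Metric.ball p ρ ⊆ U ∧ ContDiffOn ℝ ω A (Metric.ball p ρ) ∧
      ∀ q ∈ Metric.ball p ρ, ∀ f : F,
      (∃ Γ : B → B →L[ℝ] B →L[ℝ] B, ∃ U ∈ 𝓝 q, ContDiffOn ℝ ∞ Γ U ∧
        ∀ (k : ℕ) (v : Fin (k + 2) → B), m (iterCurv ad A Γ k q v) f = 0) →
      ∃ s : B → F, ContDiffOn ℝ ω s (Metric.ball p ρ) ∧ s q = f ∧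
        ∀ z ∈ Metric.ball p ρ, HasFDerivAt s (-(m.flip (s z)).comp (A z)) z := by
  obtain ⟨P, R, hP⟩ := hA
  have hc : ContinuousAt A p := hP.continuousOn.continuousAt (Metric.eball_mem_nhds p hP.r_pos)
  obtain ⟨δ, hδ0, hδR⟩ := ENNReal.lt_iff_exists_nnreal_btwn.1 hP.r_pos
  have hδ : 0 < (δ : ℝ) := by simpa using hδ0
  have hP' := hP.mono hδ0 hδR.le
  obtain ⟨ε, hε, hεb⟩ := Metric.eventually_nhds_iff_ball.1
    ((hc.norm.eventually_lt_const (show ‖A p‖ < ‖A p‖ + 1 by linarith)).and hU)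
  set C := ‖A p‖ + 1 with hCdef
  have hC : 0 < C := by positivity
  -- For `q` in the `ρ`-ball about `p`, the `2ρ`-ball about `q` contains that ball and lies in the
  -- `3ρ`-ball about `p`, where the series converges and `‖A‖ < C`. The second bound yields `‖m‖ *
  -- (C * (2 * ρ)) < 1`.
  let ρ : ℝ := min (min (δ : ℝ) ε / 3) (1 / (4 * C * (‖m‖ + 1)))
  have hρ : 0 < ρ := by positivity
  have hρδ : 3 * ρ ≤ δ := by
    have h1 : ρ ≤ min (δ : ℝ) ε / 3 := min_le_left _ _
    have h2 : min (δ : ℝ) ε ≤ δ := min_le_left _ _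
    linarith
  have hρε : 3 * ρ ≤ ε := by
    have h1 : ρ ≤ min (δ : ℝ) ε / 3 := min_le_left _ _
    have h2 : min (δ : ℝ) ε ≤ ε := min_le_right _ _
    linarith
  have hCρ : ‖m‖ * (C * (2 * ρ)) < 1 := by
    have h1 : ρ ≤ 1 / (4 * C * (‖m‖ + 1)) := min_le_right _ _
    rw [le_div_iff₀ (by positivity)] at h1
    have h2 : 0 < C * ρ := by positivity
    have h3 := norm_nonneg m
    nlinarith [mul_nonneg h3 h2.le]
  have hAan : ContDiffOn ℝ ω A (Metric.ball p δ) := by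
    rw [← Metric.eball_coe]
    exact hP'.analyticOnNhd.contDiffOn Metric.isOpen_eball.uniqueDiffOn
  have hsub : ∀ q ∈ Metric.ball p ρ, Metric.ball q (2 * ρ) ⊆ Metric.ball p (3 * ρ) :=
    fun q hq ↦ Metric.ball_subset_ball' (by have := Metric.mem_ball.1 hq; linarith)
  refine ⟨ρ, hρ, fun z hz ↦ (hεb z (Metric.ball_subset_ball (by linarith) hz)).2,
    hAan.mono (Metric.ball_subset_ball (by linarith)), fun q hq f ⟨Γ, V, hV, hΓ, hf⟩ ↦ ?_⟩
  have hqp : ‖q - p‖ < ρ := by simpa [dist_eq_norm] using hq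
  -- The recentred series converges up to radius `δ - ‖q - p‖ ≥ 2ρ`.
  have hPq := hP'.changeOrigin (y := q - p) (by
    have : ‖q - p‖₊ < δ := by
      rw [← NNReal.coe_lt_coe]; simp only [coe_nnnorm]; linarith
    exact_mod_cast this)
  rw [add_sub_cancel] at hPq
  have hPq' := hPq.mono (r' := ENNReal.ofReal (2 * ρ)) (by simpa using hρ) (by
    rw [← ENNReal.ofReal_coe_nnreal, ← ENNReal.ofReal_coe_nnreal (p := ‖q - p‖₊), coe_nnnorm,
      ← ENNReal.ofReal_sub _ (norm_nonneg _)]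
    exact ENNReal.ofReal_le_ofReal (by linarith))
  obtain ⟨s, hs, hsq, hrad⟩ := exists_radial_of_hasFPowerSeriesOnBall m hPq' (C := C)
    (fun z hz ↦ (hεb z (Metric.ball_subset_ball hρε (hsub q hq hz))).1.le) hCρ f
  have hsub' : Metric.ball p ρ ⊆ Metric.ball q (2 * ρ) :=
    Metric.ball_subset_ball' (by rw [dist_comm]; have := Metric.mem_ball.1 hq; linarith)
  obtain ⟨V', hV'V, hV'o, hqV'⟩ := mem_nhds_iff.1 hV
  have hq2 : q ∈ Metric.ball q (2 * ρ) := Metric.mem_ball_self (by linarith)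
  have hpar := parallel_of_radial hm hqV' hV'o (hΓ.mono hV'V) Metric.isOpen_ball hq2
    ((convex_ball q (2 * ρ)).starConvex hq2)
    (hAan.mono ((hsub q hq).trans (Metric.ball_subset_ball hρδ))) hs hrad
    (fun k v ↦ by rw [hsq]; exact hf k v)
  exact ⟨s, hs.mono hsub', hsq, fun z hz ↦ hpar z (hsub' hz)⟩

end ConnectionForm

/-! ### The Ricci identity and the Leibniz rule for `d + A` -/

namespace ConnectionForm

variable {B F G : Type*} [NormedAddCommGroup B] [NormedSpace ℝ B]
  [NormedAddCommGroup F] [NormedSpace ℝ F] [NormedAddCommGroup G] [NormedSpace ℝ G]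

/-- The derivative of `s` along `X` with respect to the connection `d + A`. -/
noncomputable def cov (m : G →L[ℝ] F →L[ℝ] F) (A : B → B →L[ℝ] G) (X : B → B) (s : B → F)
    (z : B) : F :=
  fderiv ℝ s z (X z) + m (A z (X z)) (s z)

lemma contDiffOn_cov {m : G →L[ℝ] F →L[ℝ] F} {A : B → B →L[ℝ] G} {X : B → B} {s : B → F}
    {U : Set B} (hU : IsOpen U) (hA : ContDiffOn ℝ ∞ A U) (hX : ContDiffOn ℝ ∞ X U)
    (hs : ContDiffOn ℝ ∞ s U) : ContDiffOn ℝ ∞ (cov m A X s) U := by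
  have h1 : ContDiffOn ℝ ∞ (fderiv ℝ s) U := hs.fderiv_of_isOpen hU (by norm_num)
  exact (h1.clm_apply hX).add (contDiffOn_clm₂ m (hA.clm_apply hX) hs)

lemma hasFDerivAt_clm₂_apply (m : G →L[ℝ] F →L[ℝ] F) {a : B → G} {s : B → F} {z : B}
    (ha : DifferentiableAt ℝ a z) (hs : DifferentiableAt ℝ s z) (v : B) :
    fderiv ℝ (fun y ↦ m (a y) (s y)) z v =
      m (a z) (fderiv ℝ s z v) + m (fderiv ℝ a z v) (s z) := by
  have h := (m.hasFDerivAt.comp z ha.hasFDerivAt).clm_apply hs.hasFDerivAt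
  rw [show (fun y ↦ m (a y) (s y)) = fun y ↦ (m ∘ a) y (s y) from rfl, h.fderiv]
  simp

lemma fderiv_cov (m : G →L[ℝ] F →L[ℝ] F) {A : B → B →L[ℝ] G} {X : B → B} {s : B → F} {z : B}
    (hA : DifferentiableAt ℝ A z) (hX : DifferentiableAt ℝ X z) (hs : DifferentiableAt ℝ s z)
    (hs' : DifferentiableAt ℝ (fderiv ℝ s) z) (v : B) :
    fderiv ℝ (cov m A X s) z v =
      fderiv ℝ (fderiv ℝ s) z v (X z) + fderiv ℝ s z (fderiv ℝ X z v)
        + m (fderiv ℝ A z v (X z) + A z (fderiv ℝ X z v)) (s z)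
        + m (A z (X z)) (fderiv ℝ s z v) := by
  have h1 := hs'.hasFDerivAt.clm_apply hX.hasFDerivAt
  have h2 := hA.hasFDerivAt.clm_apply hX.hasFDerivAt
  have h3 := hasFDerivAt_clm₂_apply m h2.differentiableAt hs v
  have h4 := (m.hasFDerivAt.comp z h2).clm_apply hs.hasFDerivAt
  have h5 : fderiv ℝ (cov m A X s) z v = fderiv ℝ (fun y ↦ fderiv ℝ s y (X y)) z v
      + fderiv ℝ (fun y ↦ m (A y (X y)) (s y)) z v := by
    rw [← add_apply]
    congr 1
    exact fderiv_add h1.differentiableAt h4.differentiableAt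
  rw [h5, h3, h1.fderiv, h2.fderiv]
  simp only [add_apply, ContinuousLinearMap.comp_apply, ContinuousLinearMap.flip_apply, map_add]
  abel

/-- The Ricci identity for the connection `d + A`. -/
lemma cov_cov_sub (m : G →L[ℝ] F →L[ℝ] F) {ad : G →L[ℝ] G →L[ℝ] G}
    (hm : ∀ a b f, m (ad a b) f = m a (m b f) - m b (m a f)) {A : B → B →L[ℝ] G}
    {X Y : B → B} {s : B → F} {z : B}
    (hA : DifferentiableAt ℝ A z) (hX : DifferentiableAt ℝ X z) (hY : DifferentiableAt ℝ Y z)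
    (hs : ContDiffAt ℝ 2 s z) :
    cov m A X (cov m A Y s) z - cov m A Y (cov m A X s) z
      - (fderiv ℝ s z (VectorField.lieBracket ℝ X Y z)
        + m (A z (VectorField.lieBracket ℝ X Y z)) (s z)) =
      m (curv ad A z (X z) (Y z)) (s z) := by
  have h1 : DifferentiableAt ℝ s z := hs.differentiableAt (by norm_num)
  have h2 : DifferentiableAt ℝ (fderiv ℝ s) z :=
    (hs.fderiv_right (m := 1) (by norm_num)).differentiableAt (by norm_num)
  have hsym : fderiv ℝ (fderiv ℝ s) z (X z) (Y z) = fderiv ℝ (fderiv ℝ s) z (Y z) (X z) :=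
    (hs.isSymmSndFDerivAt (by simp)) _ _
  simp only [cov.eq_1 m A X (cov m A Y s), cov.eq_1 m A Y (cov m A X s)]
  rw [fderiv_cov m hA hY h1 h2, fderiv_cov m hA hX h1 h2, curv_apply,
    VectorField.lieBracket_eq, hsym]
  simp only [cov, map_add, map_sub, add_apply, sub_apply, hm]
  abel

/-- The Leibniz rule characterizing the covariant derivative of an endomorphism-valued tensor. -/
lemma cov_tensor_sub (m : G →L[ℝ] F →L[ℝ] F) {ad : G →L[ℝ] G →L[ℝ] G}
    (hm : ∀ a b f, m (ad a b) f = m a (m b f) - m b (m a f)) (A : B → B →L[ℝ] G)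
    (Γ : B → B →L[ℝ] B →L[ℝ] B) {n : ℕ}
    {T : B → ContinuousMultilinearMap ℝ (fun _ : Fin n ↦ B) G} {z : B}
    (hT : DifferentiableAt ℝ T z) {X : Fin n → B → B} (hX : ∀ i, DifferentiableAt ℝ (X i) z)
    (X₀ : B → B) {s : B → F} (hs : DifferentiableAt ℝ s z) :
    cov m A X₀ (fun y ↦ m (T y (X · y)) (s y)) z
      - ∑ i, m (T z (Function.update (X · z) i
        (fderiv ℝ (X i) z (X₀ z) + Γ z (X₀ z) (X i z)))) (s z)
      - m (T z (X · z)) (cov m A X₀ s z) =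
      m (tensorCov ad A Γ T z (Fin.cons (X₀ z) (X · z))) (s z) := by
  have hTX : DifferentiableAt ℝ (fun y ↦ T y (X · y)) z :=
    (hT.hasFDerivAt.continuousMultilinearMap_apply fun i ↦ (hX i).hasFDerivAt).differentiableAt
  have key := congr(m $(fderiv_tensor_apply ad A Γ hT hX (X₀ z)) (s z))
  simp only [cov]
  rw [hasFDerivAt_clm₂_apply m hTX hs]
  simp only [map_add, add_apply, hm, map_sum, sum_apply] at key ⊢
  linear_combination (norm := module) key

end ConnectionForm

/-! ### Sections in local coordinates -/

namespace BundleCoord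

set_option linter.unusedSectionVars false

variable {B : Type*} [NormedAddCommGroup B] [NormedSpace ℝ B]
  {M : Type*} [TopologicalSpace M] [ChartedSpace B M]
  (F : Type*) [NormedAddCommGroup F] [NormedSpace ℝ F]
  {V : M → Type*} [TopologicalSpace (TotalSpace F V)]
  [∀ x, AddCommGroup (V x)] [∀ x, Module ℝ (V x)] [∀ x, TopologicalSpace (V x)]
  [FiberBundle F V] [VectorBundle ℝ F V]

/-- The fibre coordinate given by the preferred trivialization at `p`. -/
noncomputable def fiberCoord (p y : M) : V y →L[ℝ] F :=
  (trivializationAt F V p).continuousLinearMapAt ℝ y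

variable (V) in
/-- The inverse of the fibre coordinate given by the preferred trivialization at `p`. -/
noncomputable def fiberCoordSymm (p y : M) : F →L[ℝ] V y :=
  (trivializationAt F V p).symmL ℝ y

variable (V) in
/-- The part of the chart at `p` that lies in the domain of the trivialization at `p`. -/
def domain (p : M) : Set B :=
  (extChartAt 𝓘(ℝ, B) p).target ∩
    (extChartAt 𝓘(ℝ, B) p).symm ⁻¹' (trivializationAt F V p).baseSet

/-- The coordinate expression of a section near `p`. -/
noncomputable def coord (p : M) (σ : Π y, V y) (z : B) : F :=
  fiberCoord F p ((extChartAt 𝓘(ℝ, B) p).symm z) (σ ((extChartAt 𝓘(ℝ, B) p).symm z))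

variable (V) in
/-- The section with a given coordinate expression near `p`. -/
noncomputable def ofCoord (p : M) (s : B → F) (y : M) : V y :=
  fiberCoordSymm F V p y (s (extChartAt 𝓘(ℝ, B) p y))

variable (V) in
lemma isOpen_domain (p : M) : IsOpen (domain F V p : Set B) :=
  (continuousOn_extChartAt_symm p).isOpen_inter_preimage (isOpen_extChartAt_target p)
    (trivializationAt F V p).open_baseSet

variable (V) in
lemma mem_domain_self (p : M) : extChartAt 𝓘(ℝ, B) p p ∈ (domain F V p : Set B) :=
  ⟨mem_extChartAt_target p, by simp [FiberBundle.mem_baseSet_trivializationAt' p]⟩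

variable {F}

lemma fiberCoord_fiberCoordSymm {p y : M} (hy : y ∈ (trivializationAt F V p).baseSet) (f : F) :
    fiberCoord F p y (fiberCoordSymm F V p y f) = f :=
  (trivializationAt F V p).continuousLinearMapAt_symmL hy f

lemma fiberCoordSymm_fiberCoord {p y : M} (hy : y ∈ (trivializationAt F V p).baseSet) (v : V y) :
    fiberCoordSymm F V p y (fiberCoord F p y v) = v :=
  (trivializationAt F V p).symmL_continuousLinearMapAt hy v

lemma coord_ofCoord {p : M} (s : B → F) {z : B} (hz : z ∈ domain F V p) :
    coord F p (ofCoord F V p s) z = s z := by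
  rw [coord, ofCoord, fiberCoord_fiberCoordSymm hz.2, (extChartAt 𝓘(ℝ, B) p).right_inv hz.1]

variable [IsManifold 𝓘(ℝ, B) ω M] [ContMDiffVectorBundle ω F V 𝓘(ℝ, B)]

lemma contMDiffAt_iff_coord {n : ℕ∞ω} {p : M} {σ : Π y, V y} {z : B} (hz : z ∈ domain F V p) :
    ContMDiffAt 𝓘(ℝ, B) (𝓘(ℝ, B).prod 𝓘(ℝ, F)) n (fun y ↦ TotalSpace.mk' F y (σ y))
      ((extChartAt 𝓘(ℝ, B) p).symm z) ↔ ContDiffAt ℝ n (coord F p σ) z := by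
  have : IsManifold 𝓘(ℝ, B) n M := .of_le (n := ω) le_top
  have : ContMDiffVectorBundle n F V 𝓘(ℝ, B) := .of_le (n := ω) le_top
  set e := trivializationAt F V p
  set φ := extChartAt 𝓘(ℝ, B) p
  have hsymm : ContMDiffAt 𝓘(ℝ, B) 𝓘(ℝ, B) n φ.symm z :=
    (contMDiffOn_extChartAt_symm p).contMDiffAt
      ((isOpen_extChartAt_target (I := 𝓘(ℝ, B)) p).mem_nhds hz.1)
  have hsource : φ.symm z ∈ (chartAt B p).source := by
    have := φ.map_target hz.1
    rwa [extChartAt_source] at this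
  have hφ : ContMDiffAt 𝓘(ℝ, B) 𝓘(ℝ, B) n φ (φ.symm z) := contMDiffAt_extChartAt' hsource
  rw [Trivialization.contMDiffAt_section_iff e hz.2, ← contMDiffAt_iff_contDiffAt]
  constructor
  · intro h
    have h1 := ContMDiffAt.comp z (g := fun y ↦ (e ⟨y, σ y⟩).2) h hsymm
    refine h1.congr_of_eventuallyEq ?_
    filter_upwards [(isOpen_domain F V p).mem_nhds hz] with w hw
    simp only [coord, fiberCoord, Trivialization.continuousLinearMapAt_apply,
      Trivialization.coe_linearMapAt_of_mem _ hw.2, Function.comp_apply]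
    rfl
  · intro h
    rw [← φ.right_inv hz.1] at h
    refine (ContMDiffAt.comp (φ.symm z) h hφ).congr_of_eventuallyEq ?_
    filter_upwards [e.open_baseSet.mem_nhds hz.2,
      (isOpen_extChartAt_source (I := 𝓘(ℝ, B)) p).mem_nhds (φ.map_target hz.1)] with y hy hy'
    simp only [coord, fiberCoord, Trivialization.continuousLinearMapAt_apply, Function.comp_apply]
    rw [φ.left_inv hy', Trivialization.coe_linearMapAt_of_mem _ hy]

lemma contMDiffAt_ofCoord {n : ℕ∞ω} {p : M} {s : B → F} {z : B} (hz : z ∈ domain F V p)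
    (hs : ContDiffAt ℝ n s z) :
    ContMDiffAt 𝓘(ℝ, B) (𝓘(ℝ, B).prod 𝓘(ℝ, F)) n (fun y ↦ TotalSpace.mk' F y (ofCoord F V p s y))
      ((extChartAt 𝓘(ℝ, B) p).symm z) := by
  rw [contMDiffAt_iff_coord hz]
  refine hs.congr_of_eventuallyEq ?_
  filter_upwards [(isOpen_domain F V p).mem_nhds hz] with w hw using coord_ofCoord s hw

/-- The preferred trivialization of the tangent bundle lives over the whole chart source. -/
lemma domain_tangent (p : M) :
    (domain B (TangentSpace 𝓘(ℝ, B) : M → Type _) p : Set B) = (extChartAt 𝓘(ℝ, B) p).target := by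
  refine inter_eq_left.2 fun z hz ↦ ?_
  have := (extChartAt 𝓘(ℝ, B) p).map_target hz
  rwa [extChartAt_source] at this

lemma fiberCoord_tangent {p y : M} (hy : y ∈ (chartAt B p).source) :
    fiberCoord B (V := (TangentSpace 𝓘(ℝ, B) : M → Type _)) p y =
      mfderiv 𝓘(ℝ, B) 𝓘(ℝ, B) (extChartAt 𝓘(ℝ, B) p) y :=
  TangentBundle.continuousLinearMapAt_trivializationAt hy

lemma mvfderiv_comp_extChartAt {p : M} {z : B} (hz : z ∈ (extChartAt 𝓘(ℝ, B) p).target)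
    {h : B → ℝ} (hh : DifferentiableAt ℝ h z)
    (w : TangentSpace 𝓘(ℝ, B) ((extChartAt 𝓘(ℝ, B) p).symm z)) :
    mvfderiv 𝓘(ℝ, B) (fun y ↦ h (extChartAt 𝓘(ℝ, B) p y)) ((extChartAt 𝓘(ℝ, B) p).symm z) w =
      fderiv ℝ h z (fiberCoord B p ((extChartAt 𝓘(ℝ, B) p).symm z) w) := by
  set φ := extChartAt 𝓘(ℝ, B) p
  have hsource : φ.symm z ∈ (chartAt B p).source := by
    have := φ.map_target hz
    rwa [extChartAt_source] at this
  have hd : MDifferentiableAt 𝓘(ℝ, B) 𝓘(ℝ, ℝ) h (φ (φ.symm z)) := by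
    rw [φ.right_inv hz]; exact hh.mdifferentiableAt
  rw [mvfderiv, fiberCoord_tangent hsource]
  have := mfderiv_comp (φ.symm z) hd (mdifferentiableAt_extChartAt (I := 𝓘(ℝ, B)) hsource)
  rw [show (fun y ↦ h (φ y)) = h ∘ φ from rfl, this, mfderiv_eq_fderiv]
  simp only [φ.right_inv hz]
  rfl

end BundleCoord

/-! ### Connections in local coordinates -/

namespace CovariantDerivative

set_option linter.unusedSectionVars false

open BundleCoord

variable {B : Type*} [NormedAddCommGroup B] [NormedSpace ℝ B]
  {M : Type*} [TopologicalSpace M] [ChartedSpace B M]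
  {F : Type*} [NormedAddCommGroup F] [NormedSpace ℝ F] [FiniteDimensional ℝ F]
  {V : M → Type*} [TopologicalSpace (TotalSpace F V)]
  [∀ x, AddCommGroup (V x)] [∀ x, Module ℝ (V x)] [∀ x, TopologicalSpace (V x)]
  [∀ x, IsTopologicalAddGroup (V x)] [∀ x, ContinuousSMul ℝ (V x)]
  [FiberBundle F V] [VectorBundle ℝ F V]
  [IsManifold 𝓘(ℝ, B) ω M] [ContMDiffVectorBundle ω F V 𝓘(ℝ, B)]

variable (nabla : CovariantDerivative 𝓘(ℝ, B) F V)

/-- The coordinate expression near `p` of the covariant derivative of the section with constant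
coordinate expression `f`. -/
noncomputable def frameCoeff (p : M) (f : F) (z : B) : B →L[ℝ] F :=
  (fiberCoord F p ((extChartAt 𝓘(ℝ, B) p).symm z)).comp
    ((nabla (ofCoord F V p fun _ : B ↦ f) ((extChartAt 𝓘(ℝ, B) p).symm z)).comp
      (fiberCoordSymm B (TangentSpace 𝓘(ℝ, B)) p ((extChartAt 𝓘(ℝ, B) p).symm z)))

/-- The connection form of `∇` in the coordinates at `p`. -/
noncomputable def connForm (p : M) (z : B) : B →L[ℝ] F →L[ℝ] F :=
  ∑ i, (ContinuousLinearMap.smulRightL ℝ F F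
    (LinearMap.toContinuousLinearMap ((Module.finBasis ℝ F).coord i))).comp
      (nabla.frameCoeff p (Module.finBasis ℝ F i) z)

lemma connForm_apply (p : M) (z v : B) (f : F) :
    nabla.connForm p z v f =
      ∑ i, (Module.finBasis ℝ F).repr f i • nabla.frameCoeff p (Module.finBasis ℝ F i) z v := by
  simp [connForm]

/-- Additivity and the Leibniz rule. Differentiability is carried through the same induction because
additivity requires it of the partial sums. -/
lemma apply_sum_smul {ι : Type*} (t : Finset ι) {g : ι → M → ℝ} {σ : ι → Π y, V y} {y : M}
    (hg : ∀ i, MDifferentiableAt 𝓘(ℝ, B) 𝓘(ℝ, ℝ) (g i) y)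
    (hσ : ∀ i, MDifferentiableAt 𝓘(ℝ, B) (𝓘(ℝ, B).prod 𝓘(ℝ, F))
      (fun y ↦ TotalSpace.mk' F y (σ i y)) y) :
    MDifferentiableAt 𝓘(ℝ, B) (𝓘(ℝ, B).prod 𝓘(ℝ, F))
      (fun y ↦ TotalSpace.mk' F y ((∑ i ∈ t, g i • σ i) y)) y ∧
    nabla (∑ i ∈ t, g i • σ i) y =
      ∑ i ∈ t, (g i y • nabla (σ i) y + (mvfderiv 𝓘(ℝ, B) (g i) y).smulRight (σ i y)) := by
  have : ContMDiffVectorBundle 1 F V 𝓘(ℝ, B) := .of_le (n := ω) le_top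
  classical
  induction t using Finset.induction_on with
  | empty =>
    refine ⟨by simpa using! mdifferentiableAt_zeroSection ℝ V, by simp⟩
  | insert i t hi ih =>
    have h1 : MDifferentiableAt 𝓘(ℝ, B) (𝓘(ℝ, B).prod 𝓘(ℝ, F))
        (fun y ↦ TotalSpace.mk' F y ((g i • σ i) y)) y := (hg i).smul_section (hσ i)
    rw [Finset.sum_insert hi, Finset.sum_insert hi]
    refine ⟨mdifferentiableAt_add_section h1 ih.1, ?_⟩
    rw [nabla.isCovariantDerivativeOnUniv.add h1 ih.1, ih.2,
      nabla.isCovariantDerivativeOnUniv.leibniz (hσ i) (hg i)]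

/-- The covariant derivative in local coordinates. -/
lemma fiberCoord_apply {p : M} {z : B} (hz : z ∈ domain F V p) {σ : Π y, V y}
    (hσ : ContDiffAt ℝ 1 (coord F p σ) z)
    (v : TangentSpace 𝓘(ℝ, B) ((extChartAt 𝓘(ℝ, B) p).symm z)) :
    fiberCoord F p ((extChartAt 𝓘(ℝ, B) p).symm z)
        (nabla σ ((extChartAt 𝓘(ℝ, B) p).symm z) v) =
      fderiv ℝ (coord F p σ) z (fiberCoord B p ((extChartAt 𝓘(ℝ, B) p).symm z) v) +
        nabla.connForm p z (fiberCoord B p ((extChartAt 𝓘(ℝ, B) p).symm z) v)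
          (coord F p σ z) := by
  have : IsManifold 𝓘(ℝ, B) 1 M := .of_le (n := ω) le_top
  set φ := extChartAt 𝓘(ℝ, B) p
  set b := Module.finBasis ℝ F
  let c : Fin (Module.finrank ℝ F) → F →L[ℝ] ℝ := fun i ↦ LinearMap.toContinuousLinearMap (b.coord i)
  have hsource : φ.symm z ∈ (chartAt B p).source := by
    have := φ.map_target hz.1
    rwa [extChartAt_source] at this
  have hσ' : DifferentiableAt ℝ (coord F p σ) z := hσ.differentiableAt one_ne_zero
  have hσM := ((contMDiffAt_iff_coord hz).2 hσ).mdifferentiableAt one_ne_zero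
  let g : Fin (Module.finrank ℝ F) → M → ℝ := fun i y ↦ c i (coord F p σ (φ y))
  let τ : Fin (Module.finrank ℝ F) → Π y, V y := fun i ↦ ofCoord F V p fun _ : B ↦ b i
  have hcσ : ∀ i, DifferentiableAt ℝ (fun w ↦ c i (coord F p σ w)) z :=
    fun i ↦ (c i).differentiableAt.comp z hσ'
  have hg : ∀ i, MDifferentiableAt 𝓘(ℝ, B) 𝓘(ℝ, ℝ) (g i) (φ.symm z) := fun i ↦ by
    have hd : MDifferentiableAt 𝓘(ℝ, B) 𝓘(ℝ, ℝ) (fun w ↦ c i (coord F p σ w)) (φ (φ.symm z)) := by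
      rw [φ.right_inv hz.1]; exact (hcσ i).mdifferentiableAt
    exact hd.comp (φ.symm z) (mdifferentiableAt_extChartAt (I := 𝓘(ℝ, B)) hsource)
  have hτ := fun i ↦ (contMDiffAt_ofCoord (B := B) (n := 1) (F := F) (V := V) hz
    (contDiffAt_const (c := b i))).mdifferentiableAt one_ne_zero
  obtain ⟨h1, h2⟩ := nabla.apply_sum_smul Finset.univ hg hτ
  -- Expand `σ` in the frame `τ` and use that `nabla` is local. The differentiated coefficients give
  -- the `fderiv` term, the differentiated frame gives the connection form.
  have hev : ∀ᶠ y in 𝓝 (φ.symm z), σ y = (∑ i, g i • τ i) y := by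
    filter_upwards [(trivializationAt F V p).open_baseSet.mem_nhds hz.2,
      (isOpen_extChartAt_source (I := 𝓘(ℝ, B)) p).mem_nhds (φ.map_target hz.1)] with y hy hy'
    have hyz : coord F p σ (φ y) = fiberCoord F p y (σ y) := by
      rw [coord, φ.left_inv hy']
    rw [← fiberCoordSymm_fiberCoord hy (σ y), ← hyz]
    conv_lhs => rw [← b.sum_repr (coord F p σ (φ y)), map_sum]
    simp only [Finset.sum_apply, Pi.smul_apply', map_smul]
    rfl
  rw [nabla.isCovariantDerivativeOnUniv.congr_of_eventuallyEq hσM h1 Filter.univ_mem hev, h2]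
  simp only [sum_apply, add_apply, smul_apply, ContinuousLinearMap.smulRight_apply, map_sum,
    map_add, map_smul, Finset.sum_add_distrib]
  rw [add_comm]
  congr 1
  · conv_rhs => rw [← b.sum_repr (fderiv ℝ (coord F p σ) z _)]
    refine Finset.sum_congr rfl fun i _ ↦ ?_
    rw [mvfderiv_comp_extChartAt hz.1 (hcσ i)]
    have h3 : fderiv ℝ (fun w ↦ c i (coord F p σ w)) z = (c i).comp (fderiv ℝ (coord F p σ) z) :=
      ((c i).hasFDerivAt.comp z hσ'.hasFDerivAt).fderiv
    rw [h3]
    congr 1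
    exact fiberCoord_fiberCoordSymm hz.2 _
  · rw [connForm_apply]
    refine Finset.sum_congr rfl fun i _ ↦ ?_
    congr 1
    · change c i (coord F p σ (φ (φ.symm z))) = _
      rw [φ.right_inv hz.1]
      rfl
    · simp only [frameCoeff, ContinuousLinearMap.comp_apply]
      rw [fiberCoordSymm_fiberCoord]
      exact hsource

/-- A section with constant coordinates is under control only where the chart and the trivialization
are both defined, so `IsOfClass` is used on that open set. Pairing with constant coordinate fields
then gives the coefficients. -/
lemma contDiffOn_frameCoeff [FiniteDimensional ℝ B] {n : ℕ∞ω} (h : nabla.IsOfClass n) (p : M)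
    (f : F) :
    ContDiffOn ℝ n (nabla.frameCoeff p f) (domain F V p) := by
  have : ContMDiffVectorBundle n F V 𝓘(ℝ, B) := .of_le (n := ω) le_top
  have : ContMDiffVectorBundle n B (TangentSpace 𝓘(ℝ, B) : M → Type _) 𝓘(ℝ, B) :=
    .of_le (n := ω) le_top
  rw [contDiffOn_clm_apply]
  intro v z hz
  set φ := extChartAt 𝓘(ℝ, B) p
  have hW : IsOpen (φ.source ∩ (trivializationAt F V p).baseSet) :=
    (isOpen_extChartAt_source p).inter (trivializationAt F V p).open_baseSet
  have hmem : ∀ y ∈ φ.source ∩ (trivializationAt F V p).baseSet, φ y ∈ domain F V p :=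
    fun y hy ↦ ⟨φ.map_source hy.1, by rw [mem_preimage, φ.left_inv hy.1]; exact hy.2⟩
  have h1 : ContMDiffOn 𝓘(ℝ, B) (𝓘(ℝ, B).prod 𝓘(ℝ, F)) (n + 1)
      (fun y ↦ TotalSpace.mk' F y (ofCoord F V p (fun _ : B ↦ f) y))
      (φ.source ∩ (trivializationAt F V p).baseSet) := fun y hy ↦ by
    have := contMDiffAt_ofCoord (n := n + 1) (F := F) (V := V) (hmem y hy)
      (contDiffAt_const (c := f))
    rw [φ.left_inv hy.1] at this
    exact this.contMDiffWithinAt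
  have hzW : φ.symm z ∈ φ.source ∩ (trivializationAt F V p).baseSet := ⟨φ.map_target hz.1, hz.2⟩
  have hzT : z ∈ (domain B (TangentSpace 𝓘(ℝ, B) : M → Type _) p : Set B) := by
    rw [domain_tangent]; exact hz.1
  have h2 := ((h _ hW).contMDiff h1).contMDiffAt (hW.mem_nhds hzW)
  have h3 := contMDiffAt_ofCoord (n := n) (F := B) (V := (TangentSpace 𝓘(ℝ, B) : M → Type _)) hzT
    (contDiffAt_const (c := v))
  have h4 := (contMDiffAt_iff_coord hz).1 (h2.clm_bundle_apply h3)
  refine (h4.congr_of_eventuallyEq ?_).contDiffWithinAt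
  filter_upwards [(isOpen_domain F V p).mem_nhds hz] with w hw
  simp only [frameCoeff, coord, ContinuousLinearMap.comp_apply, ofCoord]

set_option synthInstance.maxHeartbeats 200000 in
lemma contDiffOn_connForm [FiniteDimensional ℝ B] {n : ℕ∞ω} (h : nabla.IsOfClass n) (p : M) :
    ContDiffOn ℝ n (nabla.connForm p) (domain F V p) := by
  rw [contDiffOn_clm_apply]
  intro v
  rw [contDiffOn_clm_apply]
  intro f
  simp only [connForm_apply]
  exact ContDiffOn.sum fun i _ ↦ contDiffOn_const.smul
    ((nabla.contDiffOn_frameCoeff h p _).clm_apply contDiffOn_const)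

end CovariantDerivative

/-- The commutator of endomorphisms, as a continuous bilinear map. -/
noncomputable def ContinuousLinearMap.commutatorL (F : Type*) [NormedAddCommGroup F]
    [NormedSpace ℝ F] : (F →L[ℝ] F) →L[ℝ] (F →L[ℝ] F) →L[ℝ] F →L[ℝ] F :=
  ContinuousLinearMap.compL ℝ F F F - (ContinuousLinearMap.compL ℝ F F F).flip

lemma ContinuousLinearMap.commutatorL_apply {F : Type*} [NormedAddCommGroup F]
    [NormedSpace ℝ F] (a b : F →L[ℝ] F) (f : F) :
    ContinuousLinearMap.id ℝ (F →L[ℝ] F) (ContinuousLinearMap.commutatorL F a b) f =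
      ContinuousLinearMap.id ℝ (F →L[ℝ] F) a (ContinuousLinearMap.id ℝ (F →L[ℝ] F) b f) -
        ContinuousLinearMap.id ℝ (F →L[ℝ] F) b (ContinuousLinearMap.id ℝ (F →L[ℝ] F) a f) := by
  simp [ContinuousLinearMap.commutatorL]

namespace ConnectionForm

variable {B F G : Type*} [NormedAddCommGroup B] [NormedSpace ℝ B]
  [NormedAddCommGroup F] [NormedSpace ℝ F] [NormedAddCommGroup G] [NormedSpace ℝ G]

lemma cov_congr {m : G →L[ℝ] F →L[ℝ] F} {A : B → B →L[ℝ] G} {X : B → B} {s t : B → F} {z : B}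
    (h : s =ᶠ[𝓝 z] t) : cov m A X s z = cov m A X t z := by
  rw [cov, cov, h.fderiv_eq, h.self_of_nhds]

set_option synthInstance.maxHeartbeats 200000 in
lemma contDiff_curryLeft {n : ℕ} {k : ℕ∞ω} : ContDiff ℝ k
    (fun T : ContinuousMultilinearMap ℝ (fun _ : Fin (n + 1) ↦ B) G ↦ T.curryLeft) :=
  (IsBoundedLinearMap.mk (𝕜 := ℝ)
    (f := fun T : ContinuousMultilinearMap ℝ (fun _ : Fin (n + 1) ↦ B) G ↦ T.curryLeft)
    ⟨fun _ _ ↦ rfl, fun _ _ ↦ rfl⟩ ⟨1, one_pos, fun L ↦ by simp⟩).contDiff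

-- Currying off the first argument reduces this, by induction on `n`, to applying continuous linear
-- maps.
set_option synthInstance.maxHeartbeats 200000 in
lemma contDiffOn_multilinear_apply {n : ℕ} {k : ℕ∞ω}
    {T : B → ContinuousMultilinearMap ℝ (fun _ : Fin n ↦ B) G} {X : Fin n → B → B} {U : Set B}
    (hT : ContDiffOn ℝ k T U) (hX : ∀ i, ContDiffOn ℝ k (X i) U) :
    ContDiffOn ℝ k (fun z ↦ T z (X · z)) U := by
  induction n with
  | zero =>
    refine (contDiffOn_clm (ContinuousMultilinearMap.apply ℝ (fun _ : Fin 0 ↦ B) G 0) hT).congr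
      fun z _ ↦ ?_
    simp [Subsingleton.elim (X · z) 0]
  | succ n ih =>
    have h0 : ContDiffOn ℝ k (fun z ↦ (T z).curryLeft) U :=
      contDiff_curryLeft.comp_contDiffOn hT
    have h1 : ContDiffOn ℝ k (fun z ↦ (T z).curryLeft (X 0 z)) U := h0.clm_apply (hX 0)
    refine (ih h1 fun i ↦ hX i.succ).congr fun z _ ↦ ?_
    rw [ContinuousMultilinearMap.curryLeft_apply]
    congr 1
    ext i
    refine Fin.cases ?_ (fun i ↦ ?_) i <;> simp

end ConnectionForm

/-! ### Curvature and its iterated derivatives in coordinates -/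

namespace CovariantDerivative

set_option linter.unusedSectionVars false

open BundleCoord ConnectionForm

variable {B : Type*} [NormedAddCommGroup B] [NormedSpace ℝ B] [FiniteDimensional ℝ B]
  {M : Type*} [TopologicalSpace M] [ChartedSpace B M]
  {F : Type*} [NormedAddCommGroup F] [NormedSpace ℝ F] [FiniteDimensional ℝ F]
  {V : M → Type*} [TopologicalSpace (TotalSpace F V)]
  [∀ x, AddCommGroup (V x)] [∀ x, Module ℝ (V x)] [∀ x, TopologicalSpace (V x)]
  [∀ x, IsTopologicalAddGroup (V x)] [∀ x, ContinuousSMul ℝ (V x)]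
  [FiberBundle F V] [VectorBundle ℝ F V]
  [IsManifold 𝓘(ℝ, B) ω M] [ContMDiffVectorBundle ω F V 𝓘(ℝ, B)]

variable (nabla : CovariantDerivative 𝓘(ℝ, B) F V)

lemma _root_.BundleCoord.coord_sub (p : M) (σ τ : Π y, V y) (z : B) :
    coord F p (σ - τ) z = coord F p σ z - coord F p τ z :=
  (fiberCoord F p _).map_sub _ _

lemma _root_.BundleCoord.coord_sum {ι : Type*} (t : Finset ι) (p : M) (σ : ι → Π y, V y) (z : B) :
    coord F p (∑ i ∈ t, σ i) z = ∑ i ∈ t, coord F p (σ i) z := by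
  rw [coord, Finset.sum_apply, map_sum]
  rfl

lemma coord_along {p : M} {z : B} (hz : z ∈ domain F V p) {σ : Π y, V y}
    (hσ : ContDiffAt ℝ 1 (coord F p σ) z) (X : Π y : M, TangentSpace 𝓘(ℝ, B) y) :
    coord F p (nabla.along X σ) z =
      cov (ContinuousLinearMap.id ℝ (F →L[ℝ] F)) (nabla.connForm p) (coord B p X)
        (coord F p σ) z :=
  nabla.fiberCoord_apply hz hσ _

/-- The pullback inverts the derivative of the inverse chart, which gives the derivative of the
chart; that is also the tangent trivialization. -/
lemma mpullback_extChartAt_symm {p : M} {z : B} (hz : z ∈ (extChartAt 𝓘(ℝ, B) p).target)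
    (X : Π y : M, TangentSpace 𝓘(ℝ, B) y) :
    VectorField.mpullback 𝓘(ℝ, B) 𝓘(ℝ, B) (extChartAt 𝓘(ℝ, B) p).symm X z = coord B p X z := by
  have hsource : (extChartAt 𝓘(ℝ, B) p).symm z ∈ (chartAt B p).source := by
    have := (extChartAt 𝓘(ℝ, B) p).map_target hz
    rwa [extChartAt_source] at this
  rw [VectorField.mpullback_apply, coord, fiberCoord_tangent hsource]
  congr 1
  have h1 := mfderivWithin_extChartAt_symm_comp_mfderiv_extChartAt (I := 𝓘(ℝ, B)) hz
  have h2 := mfderiv_extChartAt_comp_mfderivWithin_extChartAt_symm (I := 𝓘(ℝ, B)) hz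
  simp only [modelWithCornersSelf_coe, range_id, mfderivWithin_univ] at h1 h2
  exact ContinuousLinearMap.inverse_eq h1 h2

lemma mlieBracket_eq_lieBracket (X Y : Π z : B, TangentSpace 𝓘(ℝ, B) z) (z : B) :
    VectorField.mlieBracket 𝓘(ℝ, B) X Y z = VectorField.lieBracket ℝ (E := B) X Y z := by
  have h := congrFun (VectorField.mlieBracketWithin_eq_lieBracketWithin (V := X) (W := Y)
    (s := univ)) z
  rw [VectorField.mlieBracketWithin_univ] at h
  exact h.trans (congrFun (VectorField.lieBracketWithin_univ (E := B)) z)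

/-- The bracket is natural under pullback by the inverse chart, and this pullback is passage to
coordinates. -/
lemma coord_mlieBracket {p : M} {z : B} (hz : z ∈ (extChartAt 𝓘(ℝ, B) p).target)
    {X Y : Π y : M, TangentSpace 𝓘(ℝ, B) y} (hX : ContDiffAt ℝ 1 (coord B p X) z)
    (hY : ContDiffAt ℝ 1 (coord B p Y) z) :
    coord B p (VectorField.mlieBracket 𝓘(ℝ, B) X Y) z =
      VectorField.lieBracket ℝ (coord B p X) (coord B p Y) z := by
  have hzT : z ∈ (domain B (TangentSpace 𝓘(ℝ, B) : M → Type _) p : Set B) := by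
    rwa [domain_tangent]
  have ho := isOpen_extChartAt_target (I := 𝓘(ℝ, B)) p
  have h := VectorField.mpullback_mlieBracket (n := 2)
    (((contMDiffAt_iff_coord hzT).2 hX).mdifferentiableAt one_ne_zero)
    (((contMDiffAt_iff_coord hzT).2 hY).mdifferentiableAt one_ne_zero)
    ((contMDiffOn_extChartAt_symm p).contMDiffAt (ho.mem_nhds hz)) (by simp)
  refine (mpullback_extChartAt_symm hz _).symm.trans (h.trans
    ((mlieBracket_eq_lieBracket _ _ z).trans ?_))
  refine Filter.EventuallyEq.lieBracket_vectorField_eq (E := B) ?_ ?_ <;>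
  filter_upwards [ho.mem_nhds hz] with w hw using mpullback_extChartAt_symm hw _

/-- The iterated covariant derivatives of the curvature in local coordinates. -/
theorem coord_iteratedCurvatureOp
    {D : CovariantDerivative 𝓘(ℝ, B) B (TangentSpace 𝓘(ℝ, B) : M → Type _)}
    (hD : D.IsOfClass ∞) {p : M} {Ω : Set B} (hΩ : IsOpen Ω) (hΩp : Ω ⊆ domain F V p)
    (hA : ContDiffOn ℝ ∞ (nabla.connForm p) Ω) (k : ℕ) :
    ∀ (X : Fin (k + 2) → Π y : M, TangentSpace 𝓘(ℝ, B) y) (σ : Π y, V y),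
      (∀ i, ContDiffOn ℝ ∞ (coord B p (X i)) Ω) → ContDiffOn ℝ ∞ (coord F p σ) Ω →
      ∀ z ∈ Ω, coord F p (nabla.iteratedCurvatureOp D k X σ) z =
        iterCurv (ContinuousLinearMap.commutatorL F) (nabla.connForm p) (D.connForm p) k z
          (fun i ↦ coord B p (X i) z) (coord F p σ z) := by
  have hΩT : Ω ⊆ (domain B (TangentSpace 𝓘(ℝ, B) : M → Type _) p : Set B) := fun z hz ↦ by
    rw [domain_tangent]; exact (hΩp hz).1
  have hΓ : ContDiffOn ℝ ∞ (D.connForm p) Ω := (D.contDiffOn_connForm hD p).mono hΩT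
  set m := ContinuousLinearMap.id ℝ (F →L[ℝ] F)
  set ad := ContinuousLinearMap.commutatorL F
  have halong : ∀ {Y : Π y : M, TangentSpace 𝓘(ℝ, B) y} {τ : Π y, V y},
      ContDiffOn ℝ ∞ (coord F p τ) Ω →
      EqOn (coord F p (nabla.along Y τ)) (cov m (nabla.connForm p) (coord B p Y) (coord F p τ)) Ω :=
    fun hτ z hz ↦ nabla.coord_along (hΩp hz)
      ((hτ.contDiffAt (hΩ.mem_nhds hz)).of_le (by norm_num)) _
  have hsmooth : ∀ {Y : Π y : M, TangentSpace 𝓘(ℝ, B) y} {τ : Π y, V y},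
      ContDiffOn ℝ ∞ (coord B p Y) Ω → ContDiffOn ℝ ∞ (coord F p τ) Ω →
      ContDiffOn ℝ ∞ (coord F p (nabla.along Y τ)) Ω :=
    fun hY hτ ↦ (contDiffOn_cov hΩ hA hY hτ).congr (halong hτ)
  have hd : ∀ {Y : Π y : M, TangentSpace 𝓘(ℝ, B) y} {z : B}, z ∈ Ω →
      ContDiffOn ℝ ∞ (coord B p Y) Ω → ContDiffAt ℝ ∞ (coord B p Y) z :=
    fun hz h ↦ h.contDiffAt (hΩ.mem_nhds hz)
  -- The claim covers all smooth fields because the step applies it to `D_{X₀} Xᵢ` and `∇_{X₀} σ`,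
  -- and all of `Ω` because the step differentiates it.
  induction k with
  | zero =>
    intro X σ hX hσ z hz
    rw [iterCurv_zero_apply]
    change coord F p (nabla.curvatureOp (X 0) (X 1) σ) z =
      m (curv ad (nabla.connForm p) z (coord B p (X 0) z) (coord B p (X 1) z)) (coord F p σ z)
    rw [← cov_cov_sub m ContinuousLinearMap.commutatorL_apply
      ((hA.contDiffAt (hΩ.mem_nhds hz)).differentiableAt (by simp))
      ((hd hz (hX 0)).differentiableAt (by simp)) ((hd hz (hX 1)).differentiableAt (by simp))
      ((hσ.contDiffAt (hΩ.mem_nhds hz)).of_le (by norm_cast))]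
    rw [curvatureOp, coord_sub, coord_sub, halong (hsmooth (hX 1) hσ) hz,
      halong (hsmooth (hX 0) hσ) hz, halong hσ hz]
    rw [cov_congr ((halong hσ).eventuallyEq_of_mem (hΩ.mem_nhds hz)),
      cov_congr ((halong hσ).eventuallyEq_of_mem (hΩ.mem_nhds hz))]
    rw [cov.eq_1 _ _ (coord B p (VectorField.mlieBracket _ _ _)),
      coord_mlieBracket (hΩp hz).1 ((hd hz (hX 0)).of_le (by norm_num))
      ((hd hz (hX 1)).of_le (by norm_num))]
  | succ k ih =>
    intro X σ hX hσ z hz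
    have hT := contDiffOn_iterCurv (ad := ad) hΩ hA hΓ k
    have hDX : ∀ i, EqOn (coord B p (D.along (X 0) (Fin.tail X i)))
        (fun z ↦ fderiv ℝ (coord B p (Fin.tail X i)) z (coord B p (X 0) z) +
          D.connForm p z (coord B p (X 0) z) (coord B p (Fin.tail X i) z)) Ω :=
      fun i w hw ↦ D.coord_along (hΩT hw) ((hd hw (hX i.succ)).of_le (by norm_num)) _
    have hDXs : ∀ i, ContDiffOn ℝ ∞ (coord B p (D.along (X 0) (Fin.tail X i))) Ω := fun i ↦
      (contDiffOn_cov (m := ContinuousLinearMap.id ℝ (B →L[ℝ] B)) hΩ hΓ (hX 0)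
        (hX i.succ)).congr (hDX i)
    have hτ : EqOn (coord F p (nabla.iteratedCurvatureOp D k (Fin.tail X) σ))
        (fun y ↦ m (iterCurv ad (nabla.connForm p) (D.connForm p) k y
          (fun i ↦ coord B p (Fin.tail X i) y)) (coord F p σ y)) Ω :=
      fun w hw ↦ ih (Fin.tail X) σ (fun i ↦ hX i.succ) hσ w hw
    have hτs : ContDiffOn ℝ ∞ (coord F p (nabla.iteratedCurvatureOp D k (Fin.tail X) σ)) Ω := by
      refine ContDiffOn.congr ?_ hτ
      exact contDiffOn_clm₂ m (contDiffOn_multilinear_apply hT fun i ↦ hX i.succ) hσ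
    rw [iterCurv_succ]
    have hX' : (fun i ↦ coord B p (X i) z) =
        Fin.cons (coord B p (X 0) z) (fun i ↦ coord B p (Fin.tail X i) z) := by
      ext i; refine Fin.cases ?_ (fun i ↦ ?_) i <;> simp [Fin.tail]
    rw [hX']
    refine Eq.trans ?_ (cov_tensor_sub m ContinuousLinearMap.commutatorL_apply (nabla.connForm p)
      (D.connForm p) ((hT.contDiffAt (hΩ.mem_nhds hz)).differentiableAt (by simp))
      (fun i ↦ (hd hz (hX (Fin.succ i))).differentiableAt (by simp)) (coord B p (X 0))
      ((hσ.contDiffAt (hΩ.mem_nhds hz)).differentiableAt (by simp)))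
    change coord F p (nabla.tensorDeriv D (nabla.iteratedCurvatureOp D k) X σ) z = _
    rw [tensorDeriv, coord_sub, coord_sub, coord_sum, halong hτs hz,
      cov_congr (hτ.eventuallyEq_of_mem (hΩ.mem_nhds hz)),
      ih (Fin.tail X) _ (fun i ↦ hX i.succ) (hsmooth (hX 0) hσ) z hz, halong hσ hz]
    congr 2
    refine Finset.sum_congr rfl fun i _ ↦ ?_
    rw [ih _ σ (fun j ↦ ?_) hσ z hz]
    · change m _ _ = m _ _
      congr 3
      ext j
      rcases eq_or_ne j i with rfl | h
      · simp only [Function.update_self]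
        exact hDX j hz
      · simp [h]; rfl
    · rcases eq_or_ne j i with rfl | h
      · simpa using hDXs j
      · rw [Function.update_of_ne h]
        exact hX j.succ

end CovariantDerivative

/-! ### Parallel sections -/

namespace CovariantDerivative

set_option linter.unusedSectionVars false

open BundleCoord ConnectionForm

variable {B : Type*} [NormedAddCommGroup B] [NormedSpace ℝ B] [FiniteDimensional ℝ B]
  {M : Type*} [TopologicalSpace M] [ChartedSpace B M]
  {F : Type*} [NormedAddCommGroup F] [NormedSpace ℝ F] [FiniteDimensional ℝ F]
  {V : M → Type*} [TopologicalSpace (TotalSpace F V)]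
  [∀ x, AddCommGroup (V x)] [∀ x, Module ℝ (V x)] [∀ x, TopologicalSpace (V x)]
  [∀ x, IsTopologicalAddGroup (V x)] [∀ x, ContinuousSMul ℝ (V x)]
  [FiberBundle F V] [VectorBundle ℝ F V]
  [IsManifold 𝓘(ℝ, B) ω M] [ContMDiffVectorBundle ω F V 𝓘(ℝ, B)]

variable (nabla : CovariantDerivative 𝓘(ℝ, B) F V)

/-- The section `s` is smooth and parallel on `U`. -/
def IsSmoothParallelOn (s : Π y, V y) (U : Set M) : Prop :=
  ContMDiffOn 𝓘(ℝ, B) (𝓘(ℝ, B).prod 𝓘(ℝ, F)) ∞ (fun y ↦ TotalSpace.mk' F y (s y)) U ∧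
    nabla.IsParallelOn s U

/-- The vector `f` is the value of a smooth parallel section defined near `y`. -/
def HasParallelExtension (y : M) (f : V y) : Prop :=
  ∃ U : Set M, IsOpen U ∧ y ∈ U ∧ ∃ s : Π y, V y, nabla.IsSmoothParallelOn s U ∧ s y = f

variable {nabla}

lemma IsSmoothParallelOn.mono {s : Π y, V y} {U W : Set M} (hs : nabla.IsSmoothParallelOn s U)
    (h : W ⊆ U) : nabla.IsSmoothParallelOn s W :=
  ⟨hs.1.mono h, fun y hy ↦ hs.2 y (h hy)⟩

lemma mem_target_tangent {p : M} {z : B} (hz : z ∈ domain F V p) :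
    (extChartAt 𝓘(ℝ, B) p).symm z ∈
      (trivializationAt B (TangentSpace 𝓘(ℝ, B) : M → Type _) p).baseSet := by
  have : z ∈ (domain B (TangentSpace 𝓘(ℝ, B) : M → Type _) p : Set B) := by
    rw [domain_tangent]; exact hz.1
  exact this.2

lemma IsSmoothParallelOn.contDiffAt_coord {s : Π y, V y} {U : Set M} (hU : IsOpen U)
    (hs : nabla.IsSmoothParallelOn s U) {p : M} {z : B} (hz : z ∈ domain F V p)
    (hzU : (extChartAt 𝓘(ℝ, B) p).symm z ∈ U) : ContDiffAt ℝ ∞ (coord F p s) z :=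
  (contMDiffAt_iff_coord hz).1 (hs.1.contMDiffAt (hU.mem_nhds hzU))

/-- By `fiberCoord_apply`, `∇s` reads `ds + As` in coordinates. The converse passage is
`isSmoothParallelOn_ofCoord`. -/
lemma IsSmoothParallelOn.hasFDerivAt_coord {s : Π y, V y} {U : Set M} (hU : IsOpen U)
    (hs : nabla.IsSmoothParallelOn s U) {p : M} {z : B} (hz : z ∈ domain F V p)
    (hzU : (extChartAt 𝓘(ℝ, B) p).symm z ∈ U) :
    HasFDerivAt (coord F p s)
      (-((ContinuousLinearMap.id ℝ (F →L[ℝ] F)).flip (coord F p s z)).comp (nabla.connForm p z))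
      z := by
  have h1 := (hs.contDiffAt_coord hU hz hzU).of_le (m := 1) (by norm_num)
  convert (h1.differentiableAt one_ne_zero).hasFDerivAt using 1
  ext b
  have h2 := nabla.fiberCoord_apply hz h1
    (fiberCoordSymm B (TangentSpace 𝓘(ℝ, B)) p ((extChartAt 𝓘(ℝ, B) p).symm z) b)
  rw [hs.2 _ hzU, map_zero, fiberCoord_fiberCoordSymm (mem_target_tangent hz)] at h2
  exact (eq_neg_of_add_eq_zero_left h2.symm).symm

lemma isSmoothParallelOn_ofCoord {p : M} {s : B → F} {Ω : Set B} (hΩ : IsOpen Ω)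
    (hΩp : Ω ⊆ domain F V p) (hs : ContDiffOn ℝ ∞ s Ω)
    (hs' : ∀ z ∈ Ω, HasFDerivAt s
      (-((ContinuousLinearMap.id ℝ (F →L[ℝ] F)).flip (s z)).comp (nabla.connForm p z)) z) :
    nabla.IsSmoothParallelOn (ofCoord F V p s)
      ((extChartAt 𝓘(ℝ, B) p).source ∩ extChartAt 𝓘(ℝ, B) p ⁻¹' Ω) := by
  set φ := extChartAt 𝓘(ℝ, B) p
  have hsz : ∀ z ∈ Ω, ContDiffAt ℝ ∞ s z := fun z hz ↦ hs.contDiffAt (hΩ.mem_nhds hz)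
  refine ⟨fun y hy ↦ ?_, fun y hy ↦ ?_⟩
  · have := contMDiffAt_ofCoord (F := F) (V := V) (hΩp hy.2) (hsz _ hy.2)
    rw [φ.left_inv hy.1] at this
    exact this.contMDiffWithinAt
  · have key : ∀ z ∈ Ω, ∀ v : TangentSpace 𝓘(ℝ, B) (φ.symm z),
        nabla (ofCoord F V p s) (φ.symm z) v = 0 := fun z hz v ↦ by
      have hev : coord F p (ofCoord F V p s) =ᶠ[𝓝 z] s := by
        filter_upwards [hΩ.mem_nhds hz] with w hw using coord_ofCoord s (hΩp hw)
      have h := nabla.fiberCoord_apply (hΩp hz)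
        (((hsz z hz).congr_of_eventuallyEq hev).of_le (by norm_num)) v
      rw [hev.fderiv_eq, (hs' z hz).fderiv, hev.self_of_nhds] at h
      rw [← fiberCoordSymm_fiberCoord (F := F) (hΩp hz).2 (nabla _ _ v), h]
      simp only [neg_apply, ContinuousLinearMap.comp_apply, ContinuousLinearMap.flip_apply,
        ContinuousLinearMap.id_apply, neg_add_cancel, map_zero]
    have h := key _ hy.2
    rw [φ.left_inv hy.1] at h
    exact h

lemma coord_extChartAt {p y : M} (hy : y ∈ (extChartAt 𝓘(ℝ, B) p).source) (σ : Π y, V y) :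
    coord F p σ (extChartAt 𝓘(ℝ, B) p y) = fiberCoord F p y (σ y) := by
  rw [coord, (extChartAt 𝓘(ℝ, B) p).left_inv hy]

lemma isOpen_domain_inter_preimage (p : M) {U : Set M} (hU : IsOpen U) :
    IsOpen ((domain F V p : Set B) ∩ (extChartAt 𝓘(ℝ, B) p).symm ⁻¹' U) :=
  ((continuousOn_extChartAt_symm p).mono inter_subset_left).isOpen_inter_preimage
    (isOpen_domain F V p) hU

/-- Parallel sections which agree at a point agree on star-shaped sets around it. -/
lemma IsSmoothParallelOn.coord_eqOn {s t : Π y, V y} {U : Set M}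
    (hs : nabla.IsSmoothParallelOn s U) (ht : nabla.IsSmoothParallelOn t U) (hU : IsOpen U)
    {p : M} {Ω : Set B} (hΩ : Ω ⊆ domain F V p)
    (hΩU : ∀ z ∈ Ω, (extChartAt 𝓘(ℝ, B) p).symm z ∈ U) {q : B} (hstar : StarConvex ℝ q Ω)
    (hA : ContinuousOn (nabla.connForm p) Ω)
    (hst : coord F p s q = coord F p t q) : EqOn (coord F p s) (coord F p t) Ω := by
  intro z hz
  refine sub_eq_zero.1 (eq_zero_of_parallel (m := ContinuousLinearMap.id ℝ (F →L[ℝ] F))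
    (s := fun z ↦ coord F p s z - coord F p t z) hstar hA (fun z hz ↦ ?_) (sub_eq_zero.2 hst) z hz)
  refine ((hs.hasFDerivAt_coord hU (hΩ hz) (hΩU z hz)).sub
    (ht.hasFDerivAt_coord hU (hΩ hz) (hΩU z hz))).congr_fderiv ?_
  ext b
  simp only [sub_apply, neg_apply, ContinuousLinearMap.comp_apply,
    ContinuousLinearMap.flip_apply, map_sub]
  abel

/-- Parallel sections which agree at a point agree near it. -/
lemma IsSmoothParallelOn.eventually_eq (hnabla : nabla.IsOfClass ω) {s t : Π y, V y} {U : Set M}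
    (hs : nabla.IsSmoothParallelOn s U) (ht : nabla.IsSmoothParallelOn t U) (hU : IsOpen U)
    {q : M} (hq : q ∈ U) (hst : s q = t q) : ∀ᶠ y in 𝓝 q, s y = t y := by
  set φ := extChartAt 𝓘(ℝ, B) q
  have hqW : φ q ∈ (domain F V q : Set B) ∩ φ.symm ⁻¹' U :=
    ⟨mem_domain_self F V q, by
      rwa [mem_preimage, φ.left_inv (mem_extChartAt_source q)]⟩
  obtain ⟨ρ, hρ, hball⟩ :=
    Metric.isOpen_iff.1 (isOpen_domain_inter_preimage (F := F) (V := V) q hU) _ hqW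
  have h := hs.coord_eqOn ht hU (fun z hz ↦ (hball hz).1) (fun z hz ↦ (hball hz).2)
    ((convex_ball (φ q) ρ).starConvex (Metric.mem_ball_self hρ))
    ((nabla.contDiffOn_connForm hnabla q).continuousOn.mono fun z hz ↦ (hball hz).1)
    (by rw [coord_extChartAt (mem_extChartAt_source q), coord_extChartAt (mem_extChartAt_source q),
      hst])
  filter_upwards [extChartAt_source_mem_nhds (I := 𝓘(ℝ, B)) q,
    (trivializationAt F V q).open_baseSet.mem_nhds (FiberBundle.mem_baseSet_trivializationAt' q),
    (continuousAt_extChartAt (I := 𝓘(ℝ, B)) q).preimage_mem_nhds (Metric.ball_mem_nhds _ hρ)]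
    with y hy hy' hyρ
  have hy'' := h hyρ
  rw [coord_extChartAt hy, coord_extChartAt hy] at hy''
  rw [← fiberCoordSymm_fiberCoord hy' (s y), hy'', fiberCoordSymm_fiberCoord hy']

/-- Near every point there is a neighbourhood on which parallel sections are determined by any one
of their values, on which locally defined parallel sections extend, and on which formal parallel
sections at the centre integrate. -/
theorem exists_nhds_parallel (hnabla : nabla.IsOfClass ω) (p : M) :
    ∃ N : Set M, IsOpen N ∧ p ∈ N ∧
      (∀ q ∈ N, ∀ f : V q, nabla.HasParallelExtension q f →
        ∃ s, nabla.IsSmoothParallelOn s N ∧ s q = f) ∧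
      (∀ s t, nabla.IsSmoothParallelOn s N → nabla.IsSmoothParallelOn t N → ∀ q ∈ N, s q = t q →
        ∀ y ∈ N, s y = t y) ∧
      ∀ f : V p, (∃ Γ : B → B →L[ℝ] B →L[ℝ] B, ∃ U ∈ 𝓝 (extChartAt 𝓘(ℝ, B) p p),
        ContDiffOn ℝ ∞ Γ U ∧ ∀ (k : ℕ) (v : Fin (k + 2) → B),
          iterCurv (ContinuousLinearMap.commutatorL F) (nabla.connForm p) Γ k
            (extChartAt 𝓘(ℝ, B) p p) v (fiberCoord F p p f) = 0) →
        ∃ s, nabla.IsSmoothParallelOn s N ∧ s p = f := by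
  set φ := extChartAt 𝓘(ℝ, B) p
  have hmem : φ p ∈ domain F V p := mem_domain_self F V p
  have hopen : IsOpen (domain F V p : Set B) := isOpen_domain F V p
  have hA : AnalyticAt ℝ (nabla.connForm p) (φ p) :=
    ((nabla.contDiffOn_connForm hnabla p).contDiffAt (hopen.mem_nhds hmem)).analyticAt
  obtain ⟨ρ, hρ, hsub, hAρ, hex⟩ := exists_parallel_of_analyticAt
    (ContinuousLinearMap.commutatorL_apply (F := F)) hA (hopen.mem_nhds hmem)
  have hN : IsOpen (φ.source ∩ φ ⁻¹' Metric.ball (φ p) ρ) :=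
    (continuousOn_extChartAt p).isOpen_inter_preimage (isOpen_extChartAt_source p)
      Metric.isOpen_ball
  have hNt : ∀ z ∈ Metric.ball (φ p) ρ, φ.symm z ∈ φ.source ∩ φ ⁻¹' Metric.ball (φ p) ρ :=
    fun z hz ↦ ⟨φ.map_target (hsub hz).1, by rwa [mem_preimage, φ.right_inv (hsub hz).1]⟩
  have hbase : ∀ y ∈ φ.source ∩ φ ⁻¹' Metric.ball (φ p) ρ,
      y ∈ (trivializationAt F V p).baseSet := fun y hy ↦ by
    have := (hsub hy.2).2
    rwa [mem_preimage, φ.left_inv hy.1] at this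
  have hlift : ∀ q ∈ φ.source ∩ φ ⁻¹' Metric.ball (φ p) ρ, ∀ f : V q,
      (∃ s : B → F, ContDiffOn ℝ ω s (Metric.ball (φ p) ρ) ∧ s (φ q) = fiberCoord F p q f ∧
        ∀ z ∈ Metric.ball (φ p) ρ, HasFDerivAt s
          (-((ContinuousLinearMap.id ℝ (F →L[ℝ] F)).flip (s z)).comp (nabla.connForm p z)) z) →
      ∃ s, nabla.IsSmoothParallelOn s (φ.source ∩ φ ⁻¹' Metric.ball (φ p) ρ) ∧ s q = f := by
    rintro q hq f ⟨s, hs, hsq, hs'⟩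
    refine ⟨ofCoord F V p s, isSmoothParallelOn_ofCoord Metric.isOpen_ball hsub
      (hs.of_le le_top) hs', ?_⟩
    rw [ofCoord, hsq, fiberCoordSymm_fiberCoord (hbase q hq)]
  refine ⟨_, hN, ⟨mem_extChartAt_source p, Metric.mem_ball_self hρ⟩, fun q hq f hf ↦ ?_,
    fun s t hs ht q hq hst y hy ↦ ?_, fun f hf ↦ ?_⟩
  -- `Γ = 0` suffices: a parallel section is annihilated by the iterated curvature for every smooth
  -- `Γ`, so a germ at `q` meets the hypothesis of `exists_parallel_of_analyticAt` and extends to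
  -- the whole ball.
  · refine hlift q hq f (hex (φ q) hq.2 _ ⟨0, univ, Filter.univ_mem, contDiffOn_const,
      fun k v ↦ ?_⟩)
    obtain ⟨U, hU, hqU, s, hs, rfl⟩ := hf
    have hW : IsOpen ((domain F V p : Set B) ∩ φ.symm ⁻¹' U) := isOpen_domain_inter_preimage p hU
    have hqW : φ q ∈ (domain F V p : Set B) ∩ φ.symm ⁻¹' U :=
      ⟨hsub hq.2, by rwa [mem_preimage, φ.left_inv hq.1]⟩
    have h := iterCurv_parallel_eq_zero (ContinuousLinearMap.commutatorL_apply (F := F)) hW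
      (((nabla.contDiffOn_connForm hnabla p).of_le le_top).mono inter_subset_left)
      (contDiffOn_const (c := (0 : B →L[ℝ] B →L[ℝ] B)))
      (fun z hz ↦ hs.hasFDerivAt_coord hU hz.1 hz.2) k _ hqW v
    rwa [coord_extChartAt hq.1] at h
  -- A ball is star-shaped about each of its points, so agreement at any `q` suffices.
  · have h := hs.coord_eqOn ht hN hsub hNt ((convex_ball (φ p) ρ).starConvex hq.2)
      hAρ.continuousOn (by rw [coord_extChartAt hq.1, coord_extChartAt hq.1, hst]) hy.2
    rw [coord_extChartAt hy.1, coord_extChartAt hy.1] at h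
    rw [← fiberCoordSymm_fiberCoord (hbase y hy) (s y), h, fiberCoordSymm_fiberCoord (hbase y hy)]
  · exact hlift p ⟨mem_extChartAt_source p, Metric.mem_ball_self hρ⟩ f
      (hex (φ p) (Metric.mem_ball_self hρ) _ hf)

/-- `FiberBundle.extend` is constant in the trivialization at `p`. Hence the fields in the
definition of `iteratedCurvature` have constant, thus smooth, coordinates. -/
lemma coord_extend {p : M} (f : V p) {z : B} (hz : z ∈ domain F V p) :
    coord F p (FiberBundle.extend F f) z = fiberCoord F p p f := by
  have h := fiberCoord_fiberCoordSymm (F := F) hz.2 (fiberCoord F p p f)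
  rw [← h, coord, FiberBundle.extend, fiberCoordSymm, Trivialization.symmL_apply _ hz.2]
  congr 2
  rw [fiberCoord, Trivialization.continuousLinearMapAt_apply,
    Trivialization.coe_linearMapAt_of_mem _ (FiberBundle.mem_baseSet_trivializationAt' p)]

/-- A vector annihilated by all covariant derivatives of the curvature extends to a parallel
section. -/
theorem hasParallelExtension_of_iteratedCurvature (hnabla : nabla.IsOfClass ω)
    {D : CovariantDerivative 𝓘(ℝ, B) B (TangentSpace 𝓘(ℝ, B) : M → Type _)} (hD : D.IsOfClass ∞)
    {x : M} {e : V x} (hR : ∀ (k : ℕ) (v : Fin (k + 2) → TangentSpace 𝓘(ℝ, B) x),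
      nabla.iteratedCurvature D k x v e = 0) :
    nabla.HasParallelExtension x e := by
  obtain ⟨N, hN, hxN, -, -, h⟩ := exists_nhds_parallel hnabla x
  have hmem : extChartAt 𝓘(ℝ, B) x x ∈ domain F V x := mem_domain_self F V x
  have hsubT : (domain F V x : Set B) ⊆ domain B (TangentSpace 𝓘(ℝ, B) : M → Type _) x :=
    fun z hz ↦ by rw [domain_tangent]; exact hz.1
  obtain ⟨s, hs⟩ := h e ⟨D.connForm x, _, (isOpen_domain B (TangentSpace 𝓘(ℝ, B)) x).mem_nhds
    (hsubT hmem), D.contDiffOn_connForm hD x, fun k v ↦ by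
      let w : Fin (k + 2) → TangentSpace 𝓘(ℝ, B) x :=
        fun i ↦ fiberCoordSymm B (TangentSpace 𝓘(ℝ, B)) x x (v i)
      have hop := nabla.coord_iteratedCurvatureOp hD (isOpen_domain F V x) subset_rfl
        ((nabla.contDiffOn_connForm hnabla x).of_le le_top) k
        (fun i ↦ FiberBundle.extend B (w i)) (FiberBundle.extend F e)
        (fun i ↦ contDiffOn_const.congr fun z hz ↦ coord_extend (w i) (hsubT hz))
        (contDiffOn_const.congr fun z hz ↦ coord_extend e hz) _ hmem
      rw [coord_extChartAt (mem_extChartAt_source x)] at hop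
      have h0 : nabla.iteratedCurvatureOp D k (fun i ↦ FiberBundle.extend B (w i))
        (FiberBundle.extend F e) x = 0 := hR k w
      rw [h0, map_zero, coord_extend e hmem] at hop
      rw [hop]
      congr 2
      ext i
      rw [coord_extend (w i) (hsubT hmem)]
      exact (fiberCoord_fiberCoordSymm (FiberBundle.mem_baseSet_trivializationAt' x) _).symm⟩
  exact ⟨N, hN, hxN, s, hs⟩

end CovariantDerivative

/-! ### Global sections of local systems -/

/-- A local system of sets on a simply connected space, given by its flat sections `S p ξ` on
neighbourhoods `N p`, has a global flat section through every vector. -/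
theorem exists_section_of_simplyConnected {M : Type*} [TopologicalSpace M]
    [SimplyConnectedSpace M] [LocallyPathConnectedSpace M] {W : M → Type*} {N : M → Set M}
    (hN : ∀ p, IsOpen (N p)) (hpN : ∀ p, p ∈ N p) (S : ∀ p, W p → ∀ y, W y)
    (hSp : ∀ p ξ, S p ξ p = ξ) (hsurj : ∀ p, ∀ y ∈ N p, ∀ f : W y, ∃ ξ, S p ξ y = f)
    (hinj : ∀ p, ∀ y ∈ N p, ∀ ξ η, S p ξ y = S p η y → ξ = η)
    (hloc : ∀ p q ξ η y, y ∈ N p → y ∈ N q → S p ξ y = S q η y →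
      ∀ᶠ y' in 𝓝 y, S p ξ y' = S q η y') (x : M) (e : W x) :
    ∃ s : ∀ y, W y, s x = e ∧ ∀ q, ∀ᶠ y in 𝓝 q, s y = S q (s q) y := by
  let sheet : (pξ : Σ p, W p) → N pξ.1 → Σ y, W y := fun pξ y ↦ ⟨y, S pξ.1 pξ.2 y⟩
  -- The étalé space, with the final topology for all sheets. By `hloc`, sheets that meet agree
  -- nearby, so the image of each sheet is open.
  let : TopologicalSpace (Σ y, W y) := ⨆ pξ, TopologicalSpace.coinduced (sheet pξ) inferInstance
  have hopen : ∀ O : Set (Σ y, W y), IsOpen O ↔ ∀ pξ, IsOpen (sheet pξ ⁻¹' O) := fun O ↦ by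
    rw [isOpen_iSup_iff]; rfl
  have hsheet : ∀ pξ, Continuous (sheet pξ) :=
    fun pξ ↦ continuous_def.2 fun O hO ↦ (hopen O).1 hO pξ
  have hπ : Continuous (Sigma.fst : (Σ y, W y) → M) :=
    continuous_def.2 fun O hO ↦ (hopen _).2 fun pξ ↦ hO.preimage continuous_subtype_val
  have hsheetOpen : ∀ p ξ, IsOpen {t : Σ y, W y | t.1 ∈ N p ∧ S p ξ t.1 = t.2} := by
    refine fun p ξ ↦ (hopen _).2 fun qη ↦ isOpen_iff_mem_nhds.2 fun y hy ↦ ?_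
    have h := hloc p qη.1 ξ qη.2 y hy.1 y.2 hy.2
    have h' := continuous_subtype_val.continuousAt.eventually
      (h.and ((hN p).mem_nhds hy.1))
    filter_upwards [h'] with w hw using ⟨hw.2, hw.1⟩
  have hcov : IsCoveringMap (Sigma.fst : (Σ y, W y) → M) := fun p ↦ by
    let : TopologicalSpace (W p) := ⊥
    have : DiscreteTopology (W p) := ⟨rfl⟩
    -- By `hsurj` and `hinj` each point over `N p` is labelled by the unique flat section through
    -- it; with `W p` discrete this label trivializes the projection.
    choose ξ hξ using fun t : (Sigma.fst : (Σ y, W y) → M) ⁻¹' N p ↦ hsurj p t.1.1 t.2 t.1.2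
    have hH : IsEvenlyCovered (Sigma.fst : (Σ y, W y) → M) p (W p) := by
      refine ⟨inferInstance, N p, hpN p, hN p, (hN p).preimage hπ,
        { toFun := fun t ↦ (⟨t.1.1, t.2⟩, ξ t)
          invFun := fun yη ↦ ⟨sheet ⟨p, yη.2⟩ yη.1, yη.1.2⟩
          left_inv := fun t ↦ Subtype.ext (Sigma.ext rfl (heq_of_eq (hξ t)))
          right_inv := fun yη ↦ Prod.ext rfl (hinj p yη.1 yη.1.2 _ _ (hξ _))
          continuous_toFun := ?_
          continuous_invFun := ?_ }, fun _ ↦ rfl⟩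
      · refine ((hπ.comp continuous_subtype_val).subtype_mk _).prodMk
          (continuous_discrete_rng.2 fun η ↦ ?_)
        convert (hsheetOpen p η).preimage continuous_subtype_val using 1
        ext t
        refine ⟨fun h ↦ ⟨t.2, ?_⟩, fun h ↦ hinj p t.1.1 t.2 _ _ ((hξ t).trans h.2.symm)⟩
        rw [← hξ t, show ξ t = η from h]
      · exact (continuous_prod_of_discrete_right.2 fun η ↦ hsheet ⟨p, η⟩).subtype_mk _
    exact hH.to_isEvenlyCovered_preimage
  -- Simple connectivity enters here: the identity of `M` lifts through the covering.
  obtain ⟨g, ⟨hgx, hg⟩, -⟩ :=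
    hcov.existsUnique_continuousMap_lifts (ContinuousMap.id M) x ⟨x, e⟩ rfl
  have hg' : ∀ y, ∃ f : W y, g y = ⟨y, f⟩ := fun y ↦ by
    have h : (g y).1 = y := congrFun hg y
    exact ⟨h ▸ (g y).2, Sigma.ext h (by simp)⟩
  choose s hs using hg'
  refine ⟨s, by simpa using (hs x).symm.trans hgx, fun q ↦ ?_⟩
  have hq : g q ∈ {t : Σ y, W y | t.1 ∈ N q ∧ S q (s q) t.1 = t.2} := by
    rw [hs q]; exact ⟨hpN q, hSp q _⟩
  filter_upwards [g.continuous.continuousAt ((hsheetOpen q (s q)).mem_nhds hq)] with y hy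
  have hy' : g y ∈ {t : Σ y, W y | t.1 ∈ N q ∧ S q (s q) t.1 = t.2} := hy
  rw [hs y] at hy'
  exact hy'.2.symm

/-! ### From local to global parallel sections -/

namespace CovariantDerivative

set_option linter.unusedSectionVars false

variable {B : Type*} [NormedAddCommGroup B] [NormedSpace ℝ B] [FiniteDimensional ℝ B]
  {M : Type*} [TopologicalSpace M] [ChartedSpace B M]
  {F : Type*} [NormedAddCommGroup F] [NormedSpace ℝ F] [FiniteDimensional ℝ F]
  {V : M → Type*} [TopologicalSpace (TotalSpace F V)]
  [∀ x, AddCommGroup (V x)] [∀ x, Module ℝ (V x)] [∀ x, TopologicalSpace (V x)]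
  [∀ x, IsTopologicalAddGroup (V x)] [∀ x, ContinuousSMul ℝ (V x)]
  [FiberBundle F V] [VectorBundle ℝ F V]
  [IsManifold 𝓘(ℝ, B) ω M] [ContMDiffVectorBundle ω F V 𝓘(ℝ, B)]
  {nabla : CovariantDerivative 𝓘(ℝ, B) F V}

/-- Being smooth and parallel is a local property. -/
lemma isSmoothParallelOn_univ_of_eventuallyEq {s : Π y, V y}
    (h : ∀ q, ∃ U, IsOpen U ∧ q ∈ U ∧ ∃ t : Π y, V y, nabla.IsSmoothParallelOn t U ∧
      ∀ᶠ y in 𝓝 q, s y = t y) : nabla.IsSmoothParallelOn s univ := by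
  have hs : ∀ q, ContMDiffAt 𝓘(ℝ, B) (𝓘(ℝ, B).prod 𝓘(ℝ, F)) ∞
      (fun y ↦ TotalSpace.mk' F y (s y)) q := fun q ↦ by
    obtain ⟨U, hU, hq, t, ht, hst⟩ := h q
    refine (ht.1.contMDiffAt (hU.mem_nhds hq)).congr_of_eventuallyEq ?_
    filter_upwards [hst] with y hy
    rw [hy]
  refine ⟨fun q _ ↦ (hs q).contMDiffWithinAt, fun q _ v ↦ ?_⟩
  obtain ⟨U, hU, hq, t, ht, hst⟩ := h q
  rw [nabla.isCovariantDerivativeOnUniv.congr_of_eventuallyEq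
    ((hs q).mdifferentiableAt (by simp))
    ((ht.1.contMDiffAt (hU.mem_nhds hq)).mdifferentiableAt (by simp)) Filter.univ_mem hst]
  exact ht.2 q hq v

lemma hasParallelExtension_zero (y : M) : nabla.HasParallelExtension y 0 :=
  ⟨univ, isOpen_univ, mem_univ y, 0, ⟨(contMDiff_zeroSection ℝ V).contMDiffOn,
    fun y _ v ↦ by rw [nabla.zero]; rfl⟩, rfl⟩

/-- Over a simply connected base, local parallel sections extend to global ones. -/
theorem exists_global_parallel [SimplyConnectedSpace M] (hnabla : nabla.IsOfClass ω) {x : M}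
    {e : V x} (he : nabla.HasParallelExtension x e) :
    ∃ s, nabla.IsSmoothParallelOn s univ ∧ s x = e := by
  have : LocallyPathConnectedSpace M := ChartedSpace.locallyPathConnectedSpace B M
  choose N hN hpN hex huniq _ using exists_nhds_parallel (nabla := nabla) hnabla
  choose σ hσ hσp using fun p ↦ hex p p (hpN p)
  classical
  -- Only vectors with a local parallel extension are kept; they form a local system although
  -- `nabla` need not be flat.
  let W : M → Type _ := fun y ↦ {f : V y // nabla.HasParallelExtension y f}
  let S : ∀ p, W p → ∀ y, W y := fun p ξ y ↦ if h : y ∈ N p then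
    ⟨σ p ξ.1 ξ.2 y, N p, hN p, h, _, hσ p ξ.1 ξ.2, rfl⟩ else ⟨0, hasParallelExtension_zero y⟩
  have hS : ∀ p ξ y, y ∈ N p → (S p ξ y).1 = σ p ξ.1 ξ.2 y := fun p ξ y h ↦ by simp [S, h]
  obtain ⟨s, hsx, hs⟩ := exists_section_of_simplyConnected hN hpN S
    (fun p ξ ↦ Subtype.ext ((hS p ξ p (hpN p)).trans (hσp p _ _)))
    -- Extend `f` over `N p` and take the value of the extension at `p` as label.
    (fun p y hy f ↦ by
      obtain ⟨t, ht, hty⟩ := hex p y hy f.1 f.2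
      refine ⟨⟨t p, N p, hN p, hpN p, t, ht, rfl⟩, Subtype.ext ?_⟩
      rw [hS _ _ _ hy, ← hty]
      exact huniq p _ _ (hσ p _ _) ht p (hpN p) (hσp p _ _) y hy)
    (fun p y hy ξ η h ↦ by
      have h' := congrArg Subtype.val h
      rw [hS _ _ _ hy, hS _ _ _ hy] at h'
      have := huniq p _ _ (hσ p ξ.1 ξ.2) (hσ p η.1 η.2) y hy h' p (hpN p)
      rw [hσp, hσp] at this
      exact Subtype.ext this)
    (fun p q ξ η y hyp hyq h ↦ by
      have h' := congrArg Subtype.val h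
      rw [hS _ _ _ hyp, hS _ _ _ hyq] at h'
      exact (((hσ p _ _).mono inter_subset_left).eventually_eq hnabla
        ((hσ q _ _).mono inter_subset_right) ((hN p).inter (hN q)) ⟨hyp, hyq⟩ h').mp (by
          filter_upwards [(hN p).mem_nhds hyp, (hN q).mem_nhds hyq] with w hwp hwq hw
          exact Subtype.ext (by rw [hS _ _ _ hwp, hS _ _ _ hwq, hw])))
    x ⟨e, he⟩
  refine ⟨fun y ↦ (s y).1, isSmoothParallelOn_univ_of_eventuallyEq fun q ↦
    ⟨N q, hN q, hpN q, σ q (s q).1 (s q).2, hσ q _ _, ?_⟩, congrArg Subtype.val hsx⟩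
  filter_upwards [hs q, (hN q).mem_nhds (hpN q)] with y hy hyq
  rw [hy, hS _ _ _ hyq]

end CovariantDerivative

theorem proposition4p5
    {B : Type*} [NormedAddCommGroup B] [NormedSpace ℝ B] [FiniteDimensional ℝ B]
    {M : Type*} [TopologicalSpace M] [T2Space M] [ChartedSpace B M] [IsManifold 𝓘(ℝ, B) ω M]
    {F : Type*} [NormedAddCommGroup F] [NormedSpace ℝ F] [FiniteDimensional ℝ F]
    {V : M → Type*} [TopologicalSpace (TotalSpace F V)]
    [∀ x, AddCommGroup (V x)] [∀ x, Module ℝ (V x)] [∀ x, TopologicalSpace (V x)]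
    [∀ x, IsTopologicalAddGroup (V x)] [∀ x, ContinuousSMul ℝ (V x)]
    [FiberBundle F V] [VectorBundle ℝ F V] [ContMDiffVectorBundle ω F V 𝓘(ℝ, B)]
    (nabla : CovariantDerivative 𝓘(ℝ, B) F V) (hnabla : nabla.IsOfClass ω)
    (D : CovariantDerivative 𝓘(ℝ, B) B (TangentSpace 𝓘(ℝ, B) : M → Type _))
    (hD : D.IsOfClass ∞)
    (x : M) (e : V x)
    (hR : ∀ (k : ℕ) (v : Fin (k + 2) → TangentSpace 𝓘(ℝ, B) x),
      nabla.iteratedCurvature D k x v e = 0) :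
    (∃ U : Set M, IsOpen U ∧ x ∈ U ∧ ∃ s : Π y : M, V y,
      ContMDiffOn 𝓘(ℝ, B) (𝓘(ℝ, B).prod 𝓘(ℝ, F)) ∞ (fun y ↦ TotalSpace.mk' F y (s y)) U ∧
      nabla.IsParallelOn s U ∧ s x = e) ∧
    (SimplyConnectedSpace M → ∃ s : Π y : M, V y,
      ContMDiff 𝓘(ℝ, B) (𝓘(ℝ, B).prod 𝓘(ℝ, F)) ∞ (fun y ↦ TotalSpace.mk' F y (s y)) ∧
      nabla.IsParallelOn s univ ∧ s x = e) := by
  have he := CovariantDerivative.hasParallelExtension_of_iteratedCurvature hnabla hD hR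
  refine ⟨?_, fun _ ↦ ?_⟩
  · obtain ⟨U, hU, hxU, s, hs, hsx⟩ := he
    exact ⟨U, hU, hxU, s, hs.1, hs.2, hsx⟩
  · obtain ⟨s, hs, hsx⟩ := CovariantDerivative.exists_global_parallel hnabla he
    exact ⟨s, contMDiffOn_univ.1 hs.1, hs.2, hsx⟩
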